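/- For $n\ge 1$ and $|z|<1$ let $\mathrm{Li}_n(z)=\sum_{k\ge1}z^k/k^n$, and define the real numbers $$B_n+iF_n=2^{n-1}\,\mathrm{Li}_n\!\left(\tfrac{1+i}{2}\right),\qquad D_n+iG_n=\left(\tfrac23\right)^{n-1}\mathrm{Li}_n\!\left(\tfrac{1+i}{4}\right)-\mathrm{Li}_n\!\left(\tfrac{-i}{2}\right).$$ Define the meromorphic functions $$F(t)=2t\sum_{k\ge1}\frac{\left(\frac{1+i}{2}\right)^k}{k-2t},\qquad G(t)=2t\sum_{k\ge1}\left\{\frac{\left(\frac{1+i}{4}\right)^k}{k-2t/3}-\frac{\left(\frac{-i}{2}\right)^k}{k-t}\right\}.$$ Let $(a)_n=a(a+1)\cdots(a+n-1)$, ${}_2F_1(a,b;c;z)=\sum_{n\ge0}\frac{(a)_n(b)_n}{(c)_n\,n!}z^n$ and ${}_3F_2(a,b,c;d,e;z)=\sum_{n\ge0}\frac{(a)_n(b)_n(c)_n}{(d)_n(e)_n\,n!}z^n$. For a function $f$ write $(\Im f)(t)=\bigl(f(t)-\overline{f(\bar t)}\bigr)/(2i)$, which is the imaginary part of $f(t)$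 when $t$ is real. Then the following hold. 1. $F(t)=2\sum_{n\ge1}(B_n+iF_n)t^n$ for all complex $|t|<\frac12$, and $G(t)=2\sum_{n\ge1}(D_n+iG_n)t^n$ for all complex $|t|<1$. 2. (Shift recurrences.) For all complex $t$ with $2t\notin\{0,1,2,\dots\}$, $$\frac{2F(t)}{t}-\frac{iF(t-1)-i}{t-1}=\frac{2+2i}{1-2t},$$ and for all complex $t$ with $t\ne k$ and $t\ne\frac32k$ for every integer $k\ge0$, $$\frac{2^3G(t)}{t}-\frac{iG(t-3)-i}{t-3}=\frac{12+12i}{3-2t}+\frac{8i}{1-t}+\frac{4}{2-t}.$$ 3. For all complex $t$ with $\Re t<\frac12$ the following series ${}_3F_2$ converges absolutely and $$(\Im F)(t)=\frac{t}{1-t}\;{}_3F_2\!\left(\tfrac12-\tfrac12t,\ \tfrac12,\ 1;\ \tfrac32-\tfrac12t,\ 1-t;\ 1\right);$$ for $|t|<\frac12$ the right-hand side equals $2\sum_{n\ge1}F_nt^n$. 4. For all complex $t\neq1$ with $\Re t<\frac32$ the following series ${}_3F_2$ converges absolutely and $$(\Im G)(t)=\frac{t}{1-t}\;{}_3F_2\!\left(\tfrac12-\tfrac12t,\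 \tfrac12-\tfrac13t,\ 1;\ \tfrac32-\tfrac12t,\ 1-\tfrac23t;\ 1\right);$$ for $|t|<1$ the right-hand side equals $2\sum_{n\ge1}G_nt^n$. 5. $2F_1=2G_1={}_2F_1\!\left(\tfrac12,\tfrac12;\tfrac32;1\right)=\tfrac{\pi}{2}$ (here $F_1,G_1$ are the numbers $F_n,G_n$ with $n=1$). 6. Catalan's constant $\beta(2)=\sum_{k\ge0}\frac{(-1)^k}{(2k+1)^2}$ satisfies $$\beta(2)=\sum_{n=1}^{\infty}\frac{\left(\frac12\right)^{2n+1}}{2n+1}\binom{2n}{n}H_{2n},\qquad H_{2n}=\sum_{m=1}^{2n}\frac1m .$$ -/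

import Mathlib

open scoped ComplexConjugate

noncomputable section

namespace Ladder

/-- The polylogarithm `Li_n(z) = ∑_{k ≥ 1} z ^ k / k ^ n` (used for `‖z‖ < 1` only). -/
def polylog (n : ℕ) (z : ℂ) : ℂ :=
  ∑' k : ℕ, z ^ (k + 1) / ((k : ℂ) + 1) ^ n

/-- `B_n = Re (2 ^ (n - 1) Li_n((1 + i) / 2))`. -/
def B (n : ℕ) : ℝ :=
  ((2 : ℂ) ^ ((n : ℤ) - 1) * polylog n ((1 + Complex.I) / 2)).re

/-- `F_n = Im (2 ^ (n - 1) Li_n((1 + i) / 2))`. -/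
def F (n : ℕ) : ℝ :=
  ((2 : ℂ) ^ ((n : ℤ) - 1) * polylog n ((1 + Complex.I) / 2)).im

/-- `D_n = Re ((2 / 3) ^ (n - 1) Li_n((1 + i) / 4) - Li_n(-i / 2))`. -/
def D (n : ℕ) : ℝ :=
  ((2 / 3 : ℂ) ^ ((n : ℤ) - 1) * polylog n ((1 + Complex.I) / 4)
    - polylog n (-Complex.I / 2)).re

/-- `G_n = Im ((2 / 3) ^ (n - 1) Li_n((1 + i) / 4) - Li_n(-i / 2))`. -/
def G (n : ℕ) : ℝ :=
  ((2 / 3 : ℂ) ^ ((n : ℤ) - 1) * polylog n ((1 + Complex.I) / 4)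
    - polylog n (-Complex.I / 2)).im

/-- `F(t) = 2 t ∑_{k ≥ 1} ((1 + i) / 2) ^ k / (k - 2 t)`, meromorphic with poles at `2 t = 1, 2, …`. -/
def genF (t : ℂ) : ℂ :=
  2 * t * ∑' k : ℕ, ((1 + Complex.I) / 2) ^ (k + 1) / (((k : ℂ) + 1) - 2 * t)

/-- `G(t) = 2 t ∑_{k ≥ 1} (((1 + i) / 4) ^ k / (k - 2 t / 3) - (-i / 2) ^ k / (k - t))`,
meromorphic with poles among `t = k` and `t = 3 k / 2`, `k = 1, 2, …`. -/
def genG (t : ℂ) : ℂ :=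
  2 * t * ∑' k : ℕ, (((1 + Complex.I) / 4) ^ (k + 1) / (((k : ℂ) + 1) - 2 * t / 3)
    - (-Complex.I / 2) ^ (k + 1) / (((k : ℂ) + 1) - t))

/-- The imaginary part of a generating function, taken coefficientwise in the variable `t`:
`(f(t) - conj (f(conj t))) / (2 i)`. At real `t` it is the ordinary imaginary part of `f(t)`. -/
def imGen (f : ℂ → ℂ) (t : ℂ) : ℂ :=
  (f t - conj (f (conj t))) / (2 * Complex.I)

/-- The `n`-th term of the series `₃F₂(a, b, c; d, e; z)`. -/
def hyp3F2Term (a b c d e z : ℂ) (n : ℕ) : ℂ :=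
  (ascPochhammer ℂ n).eval a * (ascPochhammer ℂ n).eval b * (ascPochhammer ℂ n).eval c
    / ((ascPochhammer ℂ n).eval d * (ascPochhammer ℂ n).eval e)
    * (z ^ n / (n.factorial : ℂ))

/-- The sum of the series `₃F₂(a, b, c; d, e; z)`. -/
def hyp3F2 (a b c d e z : ℂ) : ℂ :=
  ∑' n : ℕ, hyp3F2Term a b c d e z n

/-- Catalan's constant `∑_{k ≥ 0} (-1) ^ k / (2 k + 1) ^ 2`. -/
def catalanConst : ℝ :=
  ∑' k : ℕ, (-1 : ℝ) ^ k / (2 * (k : ℝ) + 1) ^ 2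

end Ladder

end

/-!
With `L(s) = ∑_{k ≥ 1} z ^ k / (k - s)` one has `L(s) = (finitely many poles) + z ^ m L(s - m)`.
The fourth powers of `(1 + i) / 2` and `(1 + i) / 4` and the sixth power of `-i / 2` are the real
numbers `-1 / 4`, `-1 / 64` and `-1 / 64`, so `Im F(t) / t` and `Im G(t) / t` satisfy inhomogeneous
recurrences under `t ↦ t - 2` and `t ↦ t - 6`, with factors `-1 / 4` and `-1 / 64`. The `₃F₂`
series, in which two parameters differing by `1` collapse to a linear denominator, satisfy the same
recurrences by telescoping. The difference of the two sides is therefore multiplied by a number of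
modulus less than `1` at each step, while it grows at most linearly as `Re t → -∞`; hence it
vanishes.

For Catalan's constant, the double series `∑ binom (2 n) n / (4 ^ n (2 n + 2 + k) (k + 1))` is
summed in two ways. The sum over `k` is a harmonic number. The sum over `n` is `1 / (k + 1)` times
the integral of `sin ^ (k + 1)` over `[0, π / 2]`, and the values depend on the parity of `k`: the
odd powers of the sine contribute `2 β(2)`, and the even ones cancel against the last term of
`H_{2 n + 1}`.
-/

open Filter Asymptotics Topology

noncomputable section

namespace Ladder

/-- The Pochhammer symbol `(a)_n = a (a + 1) ⋯ (a + n - 1)` at a complex argument. -/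
def poch (a : ℂ) (n : ℕ) : ℂ := (ascPochhammer ℂ n).eval a

lemma poch_zero (a : ℂ) : poch a 0 = 1 := by simp [poch]

lemma poch_succ (a : ℂ) (n : ℕ) : poch a (n + 1) = poch a n * (a + n) :=
  ascPochhammer_succ_eval n a

lemma poch_eq_prod (a : ℂ) (n : ℕ) : poch a n = ∏ i ∈ Finset.range n, (a + i) := by
  induction n with
  | zero => simp [poch_zero]
  | succ n ih => rw [poch_succ, ih, Finset.prod_range_succ]

lemma poch_succ_left (a : ℂ) (n : ℕ) : poch a (n + 1) = a * poch (a + 1) n := by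
  simp [poch_eq_prod, Finset.prod_range_succ', mul_comm, add_assoc, add_comm (1 : ℂ)]

lemma poch_one (n : ℕ) : poch 1 n = n.factorial := ascPochhammer_eval_one ℂ n

lemma poch_neg_natCast_eq_zero {m n : ℕ} (h : m < n) : poch (-m) n = 0 :=
  ascPochhammer_eval_neg_coe_nat_of_lt h

lemma add_natCast_ne_zero {a : ℂ} (ha : 0 < a.re) (n : ℕ) : a + n ≠ 0 :=
  Complex.ne_zero_of_re_pos (by simpa using add_pos_of_pos_of_nonneg ha n.cast_nonneg)

lemma two_mul_natCast_add_ne_zero {a : ℂ} (ha : 0 < a.re) (n : ℕ) : 2 * (n : ℂ) + a ≠ 0 := by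
  simpa [add_comm] using add_natCast_ne_zero ha (2 * n)

lemma poch_ne_zero {a : ℂ} (ha : 0 < a.re) (n : ℕ) : poch a n ≠ 0 := by
  rw [poch_eq_prod]
  exact Finset.prod_ne_zero_iff.mpr fun i _ => add_natCast_ne_zero ha i

lemma poch_succ_eq_div_GammaSeq (a : ℂ) {n : ℕ} (hn : n ≠ 0) :
    poch a (n + 1) = n ^ a * n.factorial / Complex.GammaSeq a n := by
  have : (n : ℂ) ^ a * n.factorial ≠ 0 :=
    mul_ne_zero (by simp [Complex.cpow_eq_zero_iff, hn]) (mod_cast n.factorial_ne_zero)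
  rw [Complex.GammaSeq, ← poch_eq_prod, div_div_cancel₀ this]

lemma poch_div_poch_isBigO (a c : ℂ) :
    (fun n : ℕ => poch a (n + 1) / poch c (n + 1)) =O[atTop]
      fun n : ℕ => (n : ℝ) ^ (a.re - c.re) := by
  by_cases ha : Complex.Gamma a = 0
  · obtain ⟨m, rfl⟩ := Complex.Gamma_eq_zero_iff a |>.mp ha
    refine (isBigO_zero _ _).congr' ?_ EventuallyEq.rfl
    filter_upwards [eventually_ge_atTop m] with n hn
    rw [poch_neg_natCast_eq_zero (by lia), zero_div]
  have hlim : (fun n => Complex.GammaSeq c n / Complex.GammaSeq a n) =O[atTop] fun _ => (1 : ℝ) :=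
    ((Complex.GammaSeq_tendsto_Gamma c).div (Complex.GammaSeq_tendsto_Gamma a) ha).isBigO_one ℝ
  have hpow : (fun n : ℕ => (n : ℂ) ^ (a - c)) =O[atTop] fun n : ℕ => (n : ℝ) ^ (a.re - c.re) :=
    IsBigO.of_bound 1 <| by
      filter_upwards [eventually_gt_atTop 0] with n hn
      rw [Complex.norm_natCast_cpow_of_pos hn, one_mul, Complex.sub_re]
      exact le_abs_self _
  refine (hlim.mul hpow).congr' ?_ (.of_eq (funext fun n => one_mul _))
  filter_upwards [eventually_ne_atTop 0] with n hn
  have hfac : (n.factorial : ℂ) ≠ 0 := mod_cast n.factorial_ne_zero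
  have hcpow : (n : ℂ) ^ c ≠ 0 := by simp [Complex.cpow_eq_zero_iff, hn]
  rw [poch_succ_eq_div_GammaSeq a hn, poch_succ_eq_div_GammaSeq c hn,
    Complex.cpow_sub _ _ (Nat.cast_ne_zero.mpr hn)]
  field_simp

lemma tendsto_poch_div_poch {a c : ℂ} (hac : a.re < c.re) :
    Tendsto (fun n : ℕ => poch a n / poch c n) atTop (𝓝 0) := by
  rw [← tendsto_add_atTop_iff_nat 1]
  refine (poch_div_poch_isBigO a c).trans_tendsto ?_
  simpa [Function.comp_def] using
    (tendsto_rpow_neg_atTop (sub_pos.mpr hac)).comp (tendsto_natCast_atTop_atTop (R := ℝ))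

/-- The series `∑ (a)_n / ((c)_n (2 n + d))`: up to a factor, a `₃F₂(a, d / 2, 1; c, d / 2 + 1; 1)`
with the parameters `d / 2`, `d / 2 + 1` collapsed into a linear denominator. -/
def pochSum (a c d : ℂ) : ℂ := ∑' n : ℕ, poch a n / (poch c n * (2 * n + d))

lemma inv_natCast_add_isBigO (d : ℂ) :
    (fun n : ℕ => ((n : ℂ) + d)⁻¹) =O[atTop] fun n : ℕ => (n : ℝ)⁻¹ := by
  refine IsBigO.of_bound 2 ?_
  filter_upwards [eventually_ge_atTop (2 * ⌈‖d‖⌉₊ + 1)] with n hn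
  have hd : 2 * ‖d‖ + 1 ≤ n := by
    calc 2 * ‖d‖ + 1 ≤ 2 * ⌈‖d‖⌉₊ + 1 := by gcongr; exact Nat.le_ceil _
      _ ≤ n := mod_cast hn
  have hle : (n : ℝ) / 2 ≤ ‖(n : ℂ) + d‖ := by
    have := norm_sub_le ((n : ℂ) + d) d
    rw [add_sub_cancel_right, Complex.norm_natCast] at this
    linarith
  have hn0 : (0 : ℝ) < n := by linarith [norm_nonneg d]
  rw [norm_inv, norm_inv, Real.norm_natCast, ← div_eq_mul_inv, ← inv_div]
  exact inv_anti₀ (by positivity) hle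

lemma summable_pochSum {a c : ℂ} (hac : a.re < c.re) (d : ℂ) :
    Summable fun n : ℕ => poch a n / (poch c n * (2 * n + d)) := by
  rw [← summable_nat_add_iff 1]
  refine summable_of_isBigO_nat (g := fun n : ℕ => (n : ℝ) ^ (a.re - c.re - 1))
    (Real.summable_nat_rpow.mpr (by linarith)) ?_
  refine (((poch_div_poch_isBigO a c).mul
    (inv_natCast_add_isBigO (1 + d / 2))).const_mul_left (1 / 2)).congr' ?_ ?_
  · filter_upwards with n
    rw [← div_eq_mul_inv, div_div, div_mul_div_comm]
    push_cast
    ring_nf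
  · filter_upwards [eventually_ne_atTop 0] with n hn
    rw [Real.rpow_sub_one (by exact_mod_cast hn), div_eq_mul_inv]

lemma norm_poch_div_poch_le {a c : ℂ} {X : ℝ} (hX : 0 < X)
    (h : ∀ j : ℕ, ‖a + j‖ * (X + j + 1) ≤ (X + j) * ‖c + j‖) (n : ℕ) :
    ‖poch a n / poch c n‖ ≤ X / (X + n) := by
  induction n with
  | zero => simp [poch_zero, hX.ne']
  | succ n ih =>
    have hstep : ‖(a + n) / (c + n)‖ ≤ (X + n) / (X + n + 1) := by
      rw [norm_div]
      refine div_le_of_le_mul₀ (norm_nonneg _) (by positivity) ?_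
      rw [div_mul_eq_mul_div, le_div_iff₀ (by positivity)]
      exact h n
    rw [poch_succ, poch_succ, mul_div_mul_comm, norm_mul]
    calc ‖poch a n / poch c n‖ * ‖(a + n) / (c + n)‖
        ≤ X / (X + n) * ((X + n) / (X + n + 1)) := by gcongr
      _ = X / (X + (n + 1 : ℕ)) := by
        have : X + n ≠ 0 := by positivity
        push_cast
        field_simp
        ring

lemma norm_pochSum_le {a c d : ℂ} {X : ℝ} (hX : 1 / 2 ≤ X)
    (h : ∀ j : ℕ, ‖a + j‖ * (X + j + 1) ≤ (X + j) * ‖c + j‖) (hd : 1 ≤ d.re) :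
    ‖pochSum a c d‖ ≤ X * (Real.pi ^ 2 / 3) := by
  have hzeta : HasSum (fun n : ℕ => X * (2 * (1 / ((n : ℝ) + 1) ^ 2))) (X * (Real.pi ^ 2 / 3)) := by
    have h2 : HasSum (fun n : ℕ => 1 / ((n : ℝ) + 1) ^ 2) (Real.pi ^ 2 / 6) := by
      simpa using (hasSum_nat_add_iff' 1).mpr hasSum_zeta_two
    convert! (h2.mul_left 2).mul_left X using 1
    ring
  refine tsum_of_norm_bounded hzeta fun n => ?_
  have hden : (n : ℝ) + 1 ≤ ‖2 * (n : ℂ) + d‖ := by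
    have hre : (2 * (n : ℂ) + d).re = 2 * n + d.re := by simp
    refine le_trans ?_ (Complex.re_le_norm _)
    linarith [(n.cast_nonneg : (0 : ℝ) ≤ n)]
  rw [← div_div, norm_div]
  calc ‖poch a n / poch c n‖ / ‖2 * (n : ℂ) + d‖
      ≤ X / (X + n) / (n + 1) := by
        gcongr
        exact norm_poch_div_poch_le (by linarith) h n
    _ ≤ X / ((n + 1) / 2) / (n + 1) := by
        gcongr
        linarith [(n.cast_nonneg : (0 : ℝ) ≤ n)]
    _ = X * (2 * (1 / ((n : ℝ) + 1) ^ 2)) := by field_simp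

lemma norm_pochSum_le_of_add_one_le_re {x : ℝ} {c d : ℂ} (hx : 1 / 2 ≤ x) (hc : x + 1 ≤ c.re)
    (hd : 1 ≤ d.re) : ‖pochSum x c d‖ ≤ x * (Real.pi ^ 2 / 3) := by
  refine norm_pochSum_le hx (fun j => ?_) hd
  have hxj : 0 ≤ x + j := by positivity
  have : ‖(x : ℂ) + j‖ = x + j := by
    rw [← Complex.ofReal_natCast, ← Complex.ofReal_add, Complex.norm_of_nonneg hxj]
  rw [this]
  have hre : (c + j).re = c.re + j := by simp
  gcongr
  refine le_trans ?_ (Complex.re_le_norm _)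
  linarith

lemma norm_pochSum_two_mul_le {a d : ℂ} (ha : 1 ≤ a.re) (hd : 1 ≤ d.re) :
    ‖pochSum a (2 * a) d‖ ≤ a.re * (Real.pi ^ 2 / 3) := by
  refine norm_pochSum_le (by linarith) (fun j => ?_) hd
  have hre : (a.re + j) * (a.re + j + 1) ≤ (a.re + j) * (2 * a.re + j) :=
    mul_le_mul_of_nonneg_left (by linarith) (by linarith)
  have him : |a.im| * (a.re + j + 1) ≤ |2 * a.im| * (a.re + j) := by
    rw [abs_mul, abs_two, mul_comm 2, mul_assoc]
    gcongr
    linarith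
  refine abs_le_of_sq_le_sq' ?_ (by positivity) |>.2
  have hre2 := pow_le_pow_left₀ (by positivity) hre 2
  have him2 := pow_le_pow_left₀ (by positivity) him 2
  have h2a : (2 * a).re = 2 * a.re ∧ (2 * a).im = 2 * a.im := by simp
  simp only [mul_pow, sq_abs, Complex.sq_norm, Complex.normSq_apply, Complex.add_re, Complex.add_im,
    Complex.natCast_re, Complex.natCast_im, add_zero, h2a] at hre2 him2 ⊢
  linarith

lemma hasSum_of_telescoping {E : Type*} [AddCommGroup E] [TopologicalSpace E]
    [IsTopologicalAddGroup E] [T2Space E] {u T : ℕ → E} (hu : Summable u)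
    (h : ∀ n, u n = T n - T (n + 1)) (hT : Tendsto T atTop (𝓝 0)) : HasSum u (T 0) := by
  have hlim : Tendsto (fun n => ∑ i ∈ Finset.range n, u i) atTop (𝓝 (T 0)) := by
    simp_rw [h, Finset.sum_range_sub']
    simpa using hT.const_sub (T 0)
  rw [← tendsto_nhds_unique hu.hasSum.tendsto_sum_nat hlim]
  exact hu.hasSum

lemma poch_add (a : ℂ) (m n : ℕ) : poch a (m + n) = poch a m * poch (a + m) n := by
  simp [poch_eq_prod, Finset.prod_range_add, add_assoc]

lemma tendsto_poch_div_poch_succ {a c : ℂ} (hac : a.re < c.re + 1) :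
    Tendsto (fun n : ℕ => poch a n / poch c (n + 1)) atTop (𝓝 0) := by
  have := (tendsto_poch_div_poch (a := a) (c := c + 1) (by simpa using hac)).const_mul c⁻¹
  rw [mul_zero] at this
  refine this.congr fun n => ?_
  rw [poch_succ_left, mul_comm c, ← div_div, div_eq_inv_mul _ c]

-- The telescoping sequence on the right is the certificate found by Zeilberger's algorithm.
lemma pochSum_half_telescoping {c : ℂ} (hc : 1 / 2 < c.re) (n : ℕ) :
    poch (1 / 2) (n + 1) / (poch c (n + 1) * (2 * (n + 1 : ℕ) + c))
        + poch (1 / 2) n / (poch (c + 2) n * (2 * n + (c + 2))) / 4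
      = (1 / (2 * c - 1) * (poch (1 / 2) n / poch c n)
          - (c + 1) / (2 * (2 * c + 1)) * (poch (1 / 2) n / poch c (n + 1)))
        - (1 / (2 * c - 1) * (poch (1 / 2) (n + 1) / poch c (n + 1))
          - (c + 1) / (2 * (2 * c + 1)) * (poch (1 / 2) (n + 1) / poch c (n + 2))) := by
  have hc0 : 0 < c.re := by linarith
  have h2c : 0 < (2 * c).re := by simpa using hc0
  have h1 : c + n ≠ 0 := add_natCast_ne_zero hc0 n
  have h2 : c + (n + 1) ≠ 0 := mod_cast add_natCast_ne_zero hc0 (n + 1)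
  have h3 : 2 * (n : ℂ) + (c + 2) ≠ 0 := two_mul_natCast_add_ne_zero (add_pos hc0 two_pos) n
  have h4 : 2 * c - 1 ≠ 0 := Complex.ne_zero_of_re_pos (by simpa using (by linarith : 1 < 2 * c.re))
  have h5 : 2 * c + 1 ≠ 0 := mod_cast add_natCast_ne_zero h2c 1
  have h6 : c ≠ 0 := Complex.ne_zero_of_re_pos hc0
  have h7 : c + 1 ≠ 0 := mod_cast add_natCast_ne_zero hc0 1
  have hQ := poch_ne_zero hc0 n
  have hshift : poch (c + 2) n = poch c n * (c + n) * (c + (n + 1)) / (c * (c + 1)) := by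
    rw [eq_div_iff (mul_ne_zero h6 h7)]
    have := (poch_add c 2 n).symm.trans (congrArg (poch c) (add_comm 2 n))
    simp only [poch_succ, poch_zero, Nat.cast_add, Nat.cast_one, Nat.cast_ofNat,
      Nat.cast_zero] at this
    linear_combination this
  rw [hshift, poch_succ c (n + 1), poch_succ c n, poch_succ (1 / 2) n,
    show 2 * ((n + 1 : ℕ) : ℂ) + c = 2 * n + (c + 2) by push_cast; ring]
  push_cast
  field_simp
  ring

lemma pochSum_half_step {c : ℂ} (hc : 1 / 2 < c.re) :
    pochSum (1 / 2) c c = 1 / (2 * c - 1) + 1 / (2 * c) + 1 / (2 * (2 * c + 1))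
      - pochSum (1 / 2) (c + 2) (c + 2) / 4 := by
  have hhalf : (1 / 2 : ℂ).re < c.re := by simpa using hc
  have hs := summable_pochSum hhalf c
  have hs1 := (summable_nat_add_iff 1).mpr hs
  have hs2 := (summable_pochSum (c := c + 2) (hhalf.trans (lt_add_of_pos_right _ two_pos))
    (c + 2)).div_const 4
  have htel := hasSum_of_telescoping (hs1.add hs2) (pochSum_half_telescoping hc) <| by
    simpa using ((tendsto_poch_div_poch hhalf).const_mul (1 / (2 * c - 1))).sub
      ((tendsto_poch_div_poch_succ (hhalf.trans (lt_add_one _))).const_mul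
        ((c + 1) / (2 * (2 * c + 1))))
  have h := htel.tsum_eq
  rw [hs1.tsum_add hs2, tsum_div_const, ← pochSum] at h
  have h0 := hs.tsum_eq_zero_add
  simp only [poch_zero, poch_succ c 0, zero_add, Nat.cast_zero, mul_zero, add_zero, one_mul,
    div_one, mul_one] at h h0
  have hT : 1 / c - (c + 1) / (2 * (2 * c + 1)) * (1 / c)
      = 1 / (2 * c) + 1 / (2 * (2 * c + 1)) := by
    have hc0 : 0 < c.re := by linarith
    have h1 : c ≠ 0 := Complex.ne_zero_of_re_pos hc0
    have h2 : c * 2 + 1 ≠ 0 := mod_cast add_natCast_ne_zero (a := c * 2) (by simpa using hc0) 1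
    field_simp
    ring
  rw [pochSum, h0]
  linear_combination h + hT

lemma pochSum_two_mul_telescoping {a : ℂ} (ha : 0 < a.re) (n : ℕ) :
    poch a (n + 3) / (poch (2 * a) (n + 3) * (2 * (n + 3 : ℕ) + (3 * a - 1 / 2)))
        + poch (a + 2) n / (poch (2 * (a + 2)) n * (2 * n + (3 * (a + 2) - 1 / 2))) / 64
      = (1 / (2 * a) * (poch a (n + 2) / poch (2 * a) (n + 2))
          - (2 * a + 3) / (8 * (a + 1)) * (poch a (n + 2) / poch (2 * a) (n + 3)))
        - (1 / (2 * a) * (poch a (n + 3) / poch (2 * a) (n + 3))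
          - (2 * a + 3) / (8 * (a + 1)) * (poch a (n + 3) / poch (2 * a) (n + 4))) := by
  have h2a : 0 < (2 * a).re := by simpa using ha
  have h1 : 2 * a + (n + 2) ≠ 0 := mod_cast add_natCast_ne_zero h2a (n + 2)
  have h2 : 2 * a + (n + 3) ≠ 0 := mod_cast add_natCast_ne_zero h2a (n + 3)
  have h3 : 2 * (n : ℂ) + (3 * (a + 2) - 1 / 2) ≠ 0 :=
    two_mul_natCast_add_ne_zero (by simpa using (by linarith : 1 / 2 < 3 * (a.re + 2))) n
  have h4 : a ≠ 0 := Complex.ne_zero_of_re_pos ha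
  have h5 : a + 1 ≠ 0 := mod_cast add_natCast_ne_zero ha 1
  have h6 : 2 * a + 1 ≠ 0 := mod_cast add_natCast_ne_zero h2a 1
  have h7 : 2 * a + 3 ≠ 0 := mod_cast add_natCast_ne_zero h2a 3
  have hnum : poch a (n + 2) = a * (a + 1) * poch (a + 2) n := by
    rw [add_comm n, poch_add]
    simp [poch_succ, poch_zero]
  have hden : poch (2 * (a + 2)) n = poch (2 * a) (n + 2) * (2 * a + (n + 2)) * (2 * a + (n + 3))
      / (4 * a * (a + 1) * (2 * a + 1) * (2 * a + 3)) := by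
    rw [eq_div_iff (by simp [*])]
    have := (poch_add (2 * a) 4 n).symm.trans (congrArg (poch (2 * a)) (add_comm 4 n))
    simp only [poch_succ, poch_zero, Nat.cast_add, Nat.cast_one, Nat.cast_ofNat,
      Nat.cast_zero] at this
    simp only [show 2 * (a + 2) = 2 * a + 4 by ring, poch_succ, Nat.cast_add, Nat.cast_one]
    linear_combination this
  rw [hden, poch_succ (2 * a) (n + 3), poch_succ (2 * a) (n + 2), poch_succ a (n + 2), hnum,
    show 2 * ((n + 3 : ℕ) : ℂ) + (3 * a - 1 / 2) = 2 * n + (3 * (a + 2) - 1 / 2) by push_cast; ring]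
  push_cast
  generalize hw : 2 * a + ((n : ℂ) + 2) = w at h1 ⊢
  generalize hx : 2 * a + ((n : ℂ) + 3) = x at h2 ⊢
  generalize hy : 2 * (n : ℂ) + (3 * (a + 2) - 1 / 2) = y at h3 ⊢
  generalize hz : 2 * a + 1 = z at h6 ⊢
  generalize hv : 2 * a + 3 = v at h7 ⊢
  field_simp
  rw [← hw, ← hx, ← hy, ← hz, ← hv]
  ring

lemma pochSum_two_mul_boundary {a : ℂ} (ha : 0 < a.re) :
    a / (2 * a * (3 * a + 3 / 2)) + a * (a + 1) / (2 * a * (2 * a + 1) * (3 * a + 7 / 2))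
        + (1 / (2 * a) * (a * (a + 1) / (2 * a * (2 * a + 1)))
          - (2 * a + 3) / (8 * (a + 1)) * (a * (a + 1) / (2 * a * (2 * a + 1) * (2 * a + 2))))
      = 1 / (4 * a) + 1 / (4 * (2 * a + 1)) + 1 / (32 * (a + 1))
        - 1 / (4 * (3 * a + 3 / 2)) + 1 / (16 * (3 * a + 7 / 2)) := by
  have h1 : a ≠ 0 := Complex.ne_zero_of_re_pos ha
  have h2 : a + 1 ≠ 0 := mod_cast add_natCast_ne_zero ha 1
  have h3 : 2 * a + 1 ≠ 0 := mod_cast add_natCast_ne_zero (a := 2 * a) (by simpa using ha) 1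
  have h4 : 6 * a + 7 ≠ 0 := mod_cast add_natCast_ne_zero (a := 6 * a) (by simpa using ha) 7
  rw [show 3 * a + 3 / 2 = 3 / 2 * (2 * a + 1) by ring,
    show 3 * a + 7 / 2 = (6 * a + 7) / 2 by ring, show 2 * a + 2 = 2 * (a + 1) by ring]
  generalize hz : 2 * a + 1 = z at h3 ⊢
  generalize hv : 6 * a + 7 = v at h4 ⊢
  field_simp
  rw [← hz, ← hv]
  ring

lemma pochSum_two_mul_step {a : ℂ} (ha : 0 < a.re) :
    pochSum a (2 * a) (3 * a - 1 / 2)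
      = 1 / (4 * a) + 1 / (4 * (2 * a + 1)) + 1 / (32 * (a + 1))
        + 1 / (3 * a - 1 / 2) - 1 / (4 * (3 * a + 3 / 2)) + 1 / (16 * (3 * a + 7 / 2))
        - pochSum (a + 2) (2 * (a + 2)) (3 * (a + 2) - 1 / 2) / 64 := by
  have hre : a.re < (2 * a).re := by simpa using (by linarith : a.re < 2 * a.re)
  have hs := summable_pochSum hre (3 * a - 1 / 2)
  have hs3 := (summable_nat_add_iff 3).mpr hs
  have hs' := (summable_pochSum (a := a + 2) (c := 2 * (a + 2))
    (by simpa using (by linarith : a.re + 2 < 2 * (a.re + 2))) (3 * (a + 2) - 1 / 2)).div_const 64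
  have hlim : Tendsto (fun n : ℕ => 1 / (2 * a) * (poch a (n + 2) / poch (2 * a) (n + 2))
      - (2 * a + 3) / (8 * (a + 1)) * (poch a (n + 2) / poch (2 * a) (n + 3))) atTop (𝓝 0) := by
    refine (tendsto_add_atTop_iff_nat (f := fun n => 1 / (2 * a) * (poch a n / poch (2 * a) n)
      - (2 * a + 3) / (8 * (a + 1)) * (poch a n / poch (2 * a) (n + 1))) 2).mpr ?_
    simpa using ((tendsto_poch_div_poch hre).const_mul (1 / (2 * a))).sub
      ((tendsto_poch_div_poch_succ (hre.trans (lt_add_one _))).const_mul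
        ((2 * a + 3) / (8 * (a + 1))))
  have h := (hasSum_of_telescoping (hs3.add hs') (pochSum_two_mul_telescoping ha) hlim).tsum_eq
  rw [hs3.tsum_add hs', tsum_div_const, ← pochSum] at h
  have h0 := hs.sum_add_tsum_nat_add 3
  rw [← pochSum] at h0
  simp only [Finset.sum_range_succ, Finset.sum_range_zero, poch_zero, poch_succ, Nat.cast_zero,
    mul_zero, zero_add, add_zero, one_mul, mul_one, Nat.cast_one, Nat.cast_ofNat,
    show 2 + (3 * a - 1 / 2) = 3 * a + 3 / 2 by ring,
    show 2 * 2 + (3 * a - 1 / 2) = 3 * a + 7 / 2 by ring] at h h0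
  linear_combination h - h0 + pochSum_two_mul_boundary ha

/-- The function `∑_{k ≥ 1} w_k / (k - s)` with simple poles at the positive integers and
residues `-w_k`; the sequence is indexed so that `w k` is the coefficient of `1 / (k + 1 - s)`.
Geometric residues give `genF` and `genG`, their imaginary parts give `imGen`. -/
def poleSum (w : ℕ → ℂ) (s : ℂ) : ℂ := ∑' k : ℕ, w k / ((k : ℂ) + 1 - s)

section poleSum

variable {w : ℕ → ℂ}

lemma summable_poleSum (hw : Summable w) (s : ℂ) :
    Summable fun k : ℕ => w k / ((k : ℂ) + 1 - s) := by
  have hbdd : (fun k : ℕ => ((k : ℂ) + (1 - s))⁻¹) =O[atTop] fun _ => (1 : ℝ) :=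
    (inv_natCast_add_isBigO (1 - s)).trans <|
      (tendsto_inv_atTop_nhds_zero_nat (𝕜 := ℝ)).isBigO_one ℝ
  refine summable_of_isBigO_nat hw.norm <|
    ((isBigO_refl w atTop).norm_right.mul hbdd).congr (fun k => ?_) fun k => mul_one _
  rw [div_eq_mul_inv, add_sub_assoc]

lemma poleSum_eq_sum_add (hw : Summable w) {m : ℕ} {r : ℂ} (hr : ∀ k, w (k + m) = r * w k)
    (s : ℂ) : poleSum w s
      = ∑ j ∈ Finset.range m, w j / ((j : ℂ) + 1 - s) + r * poleSum w (s - m) := by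
  rw [poleSum, ← (summable_poleSum hw s).sum_add_tsum_nat_add m, poleSum, ← tsum_mul_left]
  congr 2
  funext k
  rw [hr, Nat.cast_add, ← mul_div_assoc]
  ring_nf

lemma norm_poleSum_le (hw : Summable w) {s : ℂ} (hs : s.re ≤ 0) :
    ‖poleSum w s‖ ≤ ∑' k, ‖w k‖ := by
  refine tsum_of_norm_bounded hw.norm.hasSum fun k => ?_
  rw [norm_div]
  have hre : ((k : ℂ) + 1 - s).re = k + 1 - s.re := by simp
  refine div_le_self (norm_nonneg _) (le_trans ?_ (Complex.re_le_norm _))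
  linarith [(k.cast_nonneg : (0 : ℝ) ≤ k)]

lemma poleSum_sub_conj (hw : Summable w) (s : ℂ) :
    poleSum w s - conj (poleSum w (conj s))
      = 2 * Complex.I * poleSum (fun k => ((w k).im : ℂ)) s := by
  have hconj : conj (poleSum w (conj s)) = poleSum (fun k => conj (w k)) s := by
    simp [poleSum, Complex.conj_tsum]
  have hw' : Summable fun k => conj (w k) := Complex.summable_conj.mpr hw
  rw [hconj, poleSum, poleSum, ← (summable_poleSum hw s).tsum_sub (summable_poleSum hw' s),
    poleSum, ← tsum_mul_left]
  congr 1
  funext k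
  rw [← sub_div, Complex.sub_conj]
  push_cast
  ring

lemma hasSum_poleSum_pow (hw : Summable w) {s : ℂ} (hs : ‖s‖ < 1) :
    HasSum (fun n : ℕ => (∑' k : ℕ, w k / ((k : ℂ) + 1) ^ (n + 1)) * s ^ n) (poleSum w s) := by
  let f : ℕ × ℕ → ℂ := fun p => w p.1 / ((p.1 : ℂ) + 1) ^ (p.2 + 1) * s ^ p.2
  have hone : ∀ k : ℕ, 1 ≤ ‖(k : ℂ) + 1‖ := fun k => by
    rw [← Nat.cast_add_one, Complex.norm_natCast]
    simp
  have hf : Summable f := by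
    refine .of_norm_bounded (hw.norm.mul_of_nonneg (summable_geometric_of_norm_lt_one hs).norm
      (fun _ => norm_nonneg _) fun _ => norm_nonneg _) fun p => ?_
    rw [norm_mul, norm_div]
    gcongr
    refine div_le_self (norm_nonneg _) ?_
    rw [norm_pow]
    exact one_le_pow₀ (hone p.1)
  have hrow : ∀ k : ℕ, HasSum (fun n => f (k, n)) (w k / ((k : ℂ) + 1 - s)) := fun k => by
    have hk : (k : ℂ) + 1 ≠ 0 := mod_cast k.succ_ne_zero
    have hlt : ‖s / ((k : ℂ) + 1)‖ < 1 := by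
      rw [norm_div]
      exact (div_le_self (norm_nonneg _) (hone k)).trans_lt hs
    convert! (hasSum_geometric_of_norm_lt_one hlt).mul_left (w k / ((k : ℂ) + 1)) using 1
    · funext n
      simp only [f, div_pow, pow_succ']
      field_simp
    · rw [← div_eq_mul_inv, div_div, mul_sub, mul_one, mul_div_cancel₀ _ hk]
  have hcol : ∀ n : ℕ, HasSum (fun k => f (k, n))
      ((∑' k : ℕ, w k / ((k : ℂ) + 1) ^ (n + 1)) * s ^ n) := fun n => by
    rw [← tsum_mul_right]
    exact (hf.comp_injective (Prod.mk_left_injective n)).hasSum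
  rw [poleSum, (hf.hasSum.prod_fiberwise hrow).tsum_eq]
  exact ((Equiv.prodComm ℕ ℕ).hasSum_iff.mpr hf.hasSum).prod_fiberwise hcol

end poleSum

lemma eq_of_shift_recurrence {f g r : ℂ → ℂ} {q h : ℂ} {σ : ℝ} (hq : ‖q‖ < 1) (hh : 0 < h.re)
    (hf : ∀ s, σ < s.re → f s = r s + q * f (s + h))
    (hg : ∀ s, σ < s.re → g s = r s + q * g (s + h))
    (hfO : f =O[comap Complex.re atTop] fun s => s.re)
    (hgO : g =O[comap Complex.re atTop] fun s => s.re) {s : ℂ} (hs : σ < s.re) : f s = g s := by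
  have hre : ∀ m : ℕ, (s + m * h).re = s.re + m * h.re := fun m => by simp
  have hmem : ∀ m : ℕ, σ < (s + m * h).re := fun m => by
    rw [hre]
    have : 0 ≤ m * h.re := by positivity
    linarith
  have hiter : ∀ m : ℕ, f s - g s = q ^ m * (f (s + m * h) - g (s + m * h)) := fun m => by
    induction m with
    | zero => simp
    | succ m ih =>
      rw [ih, hf _ (hmem m), hg _ (hmem m), Nat.cast_succ, add_one_mul, ← add_assoc]
      ring
  have hO : (fun m : ℕ => f (s + m * h) - g (s + m * h)) =O[atTop] fun m : ℕ => (s + m * h).re :=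
    (hfO.sub hgO).comp_tendsto <| tendsto_comap_iff.mpr <| by
      simp only [Function.comp_def, hre]
      exact tendsto_atTop_add_const_left _ _ (tendsto_natCast_atTop_atTop.atTop_mul_const hh)
  have hlim : Tendsto (fun m : ℕ => ‖q‖ ^ m * (s + m * h).re) atTop (𝓝 0) := by
    have h1 := (tendsto_pow_atTop_nhds_zero_of_norm_lt_one (x := ‖q‖) (by simpa)).mul_const s.re
    have h2 := (tendsto_self_mul_const_pow_of_lt_one (norm_nonneg q) hq).mul_const h.re
    refine Tendsto.congr (fun m => ?_) (by simpa using h1.add h2)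
    rw [hre]
    ring
  have hpow : (fun m : ℕ => q ^ m) =O[atTop] fun m => ‖q‖ ^ m :=
    .of_norm_le fun m => (norm_pow q m).le
  have hzero := ((hpow.mul hO).congr_left fun m => (hiter m).symm).trans_tendsto hlim
  exact sub_eq_zero.mp (tendsto_nhds_unique tendsto_const_nhds hzero)

/-- The sum `∑_{k ≥ 1} z ^ k / (k - s)`, a Lerch transcendent. -/
def lerch (z s : ℂ) : ℂ := poleSum (fun k => z ^ (k + 1)) s

/-- The sum `∑_{k ≥ 1} Im (z ^ k) / (k - s)`, which is the imaginary part of `lerch z s`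
when `s` is real. -/
def lerchIm (z s : ℂ) : ℂ := poleSum (fun k => ((z ^ (k + 1)).im : ℂ)) s

section lerch

variable {z : ℂ}

lemma summable_pow_succ (hz : ‖z‖ < 1) : Summable fun k : ℕ => z ^ (k + 1) :=
  (summable_nat_add_iff 1).mpr (summable_geometric_of_norm_lt_one hz)

lemma summable_im_pow_succ (hz : ‖z‖ < 1) : Summable fun k : ℕ => ((z ^ (k + 1)).im : ℂ) :=
  Complex.summable_ofReal.mpr (Complex.hasSum_im (summable_pow_succ hz).hasSum).summable

lemma lerch_eq_sum_add (hz : ‖z‖ < 1) (m : ℕ) (s : ℂ) :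
    lerch z s = ∑ j ∈ Finset.range m, z ^ (j + 1) / ((j : ℂ) + 1 - s) + z ^ m * lerch z (s - m) :=
  poleSum_eq_sum_add (summable_pow_succ hz) (fun k => by ring) s

lemma lerchIm_eq_sum_add (hz : ‖z‖ < 1) {m : ℕ} {r : ℝ} (hr : z ^ m = r) (s : ℂ) :
    lerchIm z s = ∑ j ∈ Finset.range m, ((z ^ (j + 1)).im : ℂ) / ((j : ℂ) + 1 - s)
      + r * lerchIm z (s - m) := by
  refine poleSum_eq_sum_add (summable_im_pow_succ hz) (fun k => ?_) s
  rw [show k + m + 1 = m + (k + 1) by ring, pow_add, hr, Complex.im_ofReal_mul, Complex.ofReal_mul]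

lemma lerch_sub_conj (hz : ‖z‖ < 1) (s : ℂ) :
    lerch z s - conj (lerch z (conj s)) = 2 * Complex.I * lerchIm z s :=
  poleSum_sub_conj (summable_pow_succ hz) s

lemma hasSum_polylog_mul_pow (hz : ‖z‖ < 1) {s : ℂ} (hs : ‖s‖ < 1) :
    HasSum (fun n : ℕ => polylog (n + 1) z * s ^ n) (lerch z s) :=
  hasSum_poleSum_pow (summable_pow_succ hz) hs

lemma lerchIm_comp_isBigO (hz : ‖z‖ < 1) {φ : ℂ → ℂ}
    (hφ : ∀ᶠ s in comap Complex.re atTop, (φ s).re ≤ 0) :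
    (fun s => lerchIm z (φ s)) =O[comap Complex.re atTop] fun s => s.re := by
  have hbdd : (fun s => lerchIm z (φ s)) =O[comap Complex.re atTop] fun _ => (1 : ℝ) :=
    .of_bound (∑' k : ℕ, ‖((z ^ (k + 1)).im : ℂ)‖) <| hφ.mono fun s hs => by
      rw [norm_one, mul_one]
      exact norm_poleSum_le (summable_im_pow_succ hz) hs
  refine hbdd.trans (.of_bound 1 ?_)
  filter_upwards [tendsto_comap.eventually_ge_atTop (1 : ℝ)] with s hs
  simpa using hs.trans (le_abs_self _)

end lerch

lemma norm_one_add_I_div_two_lt_one : ‖(1 + Complex.I) / 2‖ < 1 := by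
  rw [← sq_lt_one_iff₀ (norm_nonneg _), Complex.sq_norm, Complex.normSq_apply]
  norm_num

lemma norm_one_add_I_div_four_lt_one : ‖(1 + Complex.I) / 4‖ < 1 := by
  rw [← sq_lt_one_iff₀ (norm_nonneg _), Complex.sq_norm, Complex.normSq_apply]
  norm_num

lemma norm_neg_I_div_two_lt_one : ‖-Complex.I / 2‖ < 1 := by
  norm_num

lemma one_add_I_div_two_sq : ((1 + Complex.I) / 2) ^ 2 = Complex.I / 2 := by
  linear_combination Complex.I_sq / 4

lemma one_add_I_div_four_sq : ((1 + Complex.I) / 4) ^ 2 = Complex.I / 8 := by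
  linear_combination Complex.I_sq / 16

lemma neg_I_div_two_sq : (-Complex.I / 2) ^ 2 = -1 / 4 := by
  linear_combination Complex.I_sq / 4

lemma neg_I_div_two_cube : (-Complex.I / 2) ^ 3 = Complex.I / 8 := by
  linear_combination -Complex.I / 2 * neg_I_div_two_sq

lemma genF_eq (t : ℂ) : genF t = 2 * t * lerch ((1 + Complex.I) / 2) (2 * t) := rfl

lemma genG_eq (t : ℂ) : genG t
    = 2 * t * (lerch ((1 + Complex.I) / 4) (2 * t / 3) - lerch (-Complex.I / 2) t) := by
  rw [genG, Summable.tsum_sub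
    (summable_poleSum (summable_pow_succ norm_one_add_I_div_four_lt_one) _)
    (summable_poleSum (summable_pow_succ norm_neg_I_div_two_lt_one) _)]
  rfl

lemma genF_shift {t : ℂ} (ht : ∀ k : ℕ, 2 * t ≠ k) :
    2 * genF t / t - (Complex.I * genF (t - 1) - Complex.I) / (t - 1)
      = (2 + 2 * Complex.I) / (1 - 2 * t) := by
  have ht0 : t ≠ 0 := by simpa using ht 0
  have ht1 : t - 1 ≠ 0 := fun h => ht 2 (by push_cast; linear_combination 2 * h)
  have hpole : Complex.I / 2 / (2 - 2 * t) = -(Complex.I / (t - 1)) / 4 := by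
    rw [show 2 - 2 * t = -2 * (t - 1) by ring]
    field_simp
    norm_num
  have hF : 2 * genF t / t = 4 * lerch ((1 + Complex.I) / 2) (2 * t) := by
    rw [genF_eq]
    field_simp
    ring
  have hF1 : (Complex.I * genF (t - 1) - Complex.I) / (t - 1)
      = 2 * Complex.I * lerch ((1 + Complex.I) / 2) (2 * t - 2) - Complex.I / (t - 1) := by
    rw [genF_eq, mul_sub, mul_one]
    field_simp
  have hL := lerch_eq_sum_add norm_one_add_I_div_two_lt_one 2 (2 * t)
  simp only [Finset.sum_range_succ, Finset.sum_range_zero, one_add_I_div_two_sq, zero_add,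
    Nat.cast_zero, Nat.cast_one, Nat.cast_ofNat, pow_one, one_add_one_eq_two, hpole] at hL
  rw [hF, hF1, hL]
  ring

lemma genG_shift {t : ℂ} (ht : ∀ k : ℕ, t ≠ k ∧ 2 * t ≠ 3 * k) :
    2 ^ 3 * genG t / t - (Complex.I * genG (t - 3) - Complex.I) / (t - 3)
      = (12 + 12 * Complex.I) / (3 - 2 * t) + 8 * Complex.I / (1 - t) + 4 / (2 - t) := by
  have ht0 : t ≠ 0 := by simpa using (ht 0).1
  have ht3 : t - 3 ≠ 0 := sub_ne_zero.mpr (by simpa using (ht 3).1)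
  have hpole1 : (1 + Complex.I) / 4 / (1 - 2 * t / 3)
      = 3 / 4 * ((1 + Complex.I) / (3 - 2 * t)) := by
    rw [show 1 - 2 * t / 3 = (3 - 2 * t) / 3 by ring, div_div_eq_mul_div]
    ring
  have hpole2 : Complex.I / 8 / (2 - 2 * t / 3) = -3 / 16 * (Complex.I / (t - 3)) := by
    rw [show 2 - 2 * t / 3 = -2 / 3 * (t - 3) by ring]
    field_simp
    norm_num
  have hpole3 : Complex.I / 8 / (3 - t) = -1 / 8 * (Complex.I / (t - 3)) := by
    rw [← neg_sub t 3, div_neg]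
    ring
  have hG : 2 ^ 3 * genG t / t
      = 16 * (lerch ((1 + Complex.I) / 4) (2 * t / 3) - lerch (-Complex.I / 2) t) := by
    rw [genG_eq]
    field_simp
    ring
  have hG3 : (Complex.I * genG (t - 3) - Complex.I) / (t - 3)
      = 2 * Complex.I * (lerch ((1 + Complex.I) / 4) (2 * t / 3 - 2)
        - lerch (-Complex.I / 2) (t - 3)) - Complex.I / (t - 3) := by
    rw [genG_eq, show 2 * (t - 3) / 3 = 2 * t / 3 - 2 by ring]
    field_simp
  have hL1 := lerch_eq_sum_add norm_one_add_I_div_four_lt_one 2 (2 * t / 3)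
  have hL2 := lerch_eq_sum_add norm_neg_I_div_two_lt_one 3 t
  simp only [Finset.sum_range_succ, Finset.sum_range_zero, one_add_I_div_four_sq,
    neg_I_div_two_sq, neg_I_div_two_cube, zero_add, Nat.cast_zero, Nat.cast_one, Nat.cast_ofNat,
    pow_one, one_add_one_eq_two, two_add_one_eq_three, hpole1, hpole2, hpole3] at hL1 hL2
  rw [hG, hG3, hL1, hL2]
  ring

lemma two_mul_I_ne_zero : 2 * Complex.I ≠ 0 := mul_ne_zero two_ne_zero Complex.I_ne_zero

lemma imGen_genF (t : ℂ) :
    imGen genF t = 2 * t * lerchIm ((1 + Complex.I) / 2) (2 * t) := by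
  have h := lerch_sub_conj norm_one_add_I_div_two_lt_one (2 * t)
  rw [imGen, div_eq_iff two_mul_I_ne_zero, genF_eq, genF_eq]
  simp only [map_mul, map_ofNat, Complex.conj_conj] at h ⊢
  linear_combination 2 * t * h

lemma imGen_genG (t : ℂ) : imGen genG t
    = 2 * t * (lerchIm ((1 + Complex.I) / 4) (2 * t / 3) - lerchIm (-Complex.I / 2) t) := by
  have h1 := lerch_sub_conj norm_one_add_I_div_four_lt_one (2 * t / 3)
  have h2 := lerch_sub_conj norm_neg_I_div_two_lt_one t
  rw [imGen, div_eq_iff two_mul_I_ne_zero, genG_eq, genG_eq]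
  simp only [map_mul, map_sub, map_div₀, map_ofNat, Complex.conj_conj] at h1 h2 ⊢
  linear_combination 2 * t * (h1 - h2)

lemma hasSum_imGen {f : ℂ → ℂ} {b c : ℕ → ℝ} {ρ : ℝ}
    (hf : ∀ t : ℂ, ‖t‖ < ρ →
      HasSum (fun n : ℕ => 2 * ((b (n + 1) : ℂ) + Complex.I * (c (n + 1) : ℂ)) * t ^ (n + 1)) (f t))
    {t : ℂ} (ht : ‖t‖ < ρ) :
    HasSum (fun n : ℕ => 2 * (c (n + 1) : ℂ) * t ^ (n + 1)) (imGen f t) := by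
  have hconj := Complex.hasSum_conj'.mpr (hf (conj t) (by simpa using ht))
  convert! ((hf t ht).sub hconj).div_const (2 * Complex.I) using 1
  funext n
  rw [eq_div_iff two_mul_I_ne_zero]
  simp only [map_mul, map_add, map_pow, map_ofNat, Complex.conj_ofReal, Complex.conj_I,
    Complex.conj_conj]
  ring

lemma lerchIm_one_add_I_div_two_shift (s : ℂ) :
    lerchIm ((1 + Complex.I) / 2) s = 1 / 2 / (1 - s) + 1 / 2 / (2 - s) + 1 / 4 / (3 - s)
      - lerchIm ((1 + Complex.I) / 2) (s - 4) / 4 := by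
  have h3 : ((1 + Complex.I) / 2) ^ 3 = (-1 + Complex.I) / 4 := by
    linear_combination (3 + Complex.I) / 8 * Complex.I_sq
  have h4 : ((1 + Complex.I) / 2) ^ 4 = ((-1 / 4 : ℝ) : ℂ) := by
    push_cast
    linear_combination (Complex.I ^ 2 + 4 * Complex.I + 5) / 16 * Complex.I_sq
  have h := lerchIm_eq_sum_add norm_one_add_I_div_two_lt_one h4 s
  norm_num [Finset.sum_range_succ, one_add_I_div_two_sq, h3, h4] at h
  rw [h]
  ring

lemma lerchIm_one_add_I_div_four_shift (s : ℂ) :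
    lerchIm ((1 + Complex.I) / 4) s = 1 / 4 / (1 - s) + 1 / 8 / (2 - s) + 1 / 32 / (3 - s)
      - lerchIm ((1 + Complex.I) / 4) (s - 4) / 64 := by
  have h3 : ((1 + Complex.I) / 4) ^ 3 = (-1 + Complex.I) / 32 := by
    linear_combination (3 + Complex.I) / 64 * Complex.I_sq
  have h4 : ((1 + Complex.I) / 4) ^ 4 = ((-1 / 64 : ℝ) : ℂ) := by
    push_cast
    linear_combination (Complex.I ^ 2 + 4 * Complex.I + 5) / 256 * Complex.I_sq
  have h := lerchIm_eq_sum_add norm_one_add_I_div_four_lt_one h4 s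
  norm_num [Finset.sum_range_succ, one_add_I_div_four_sq, h3, h4] at h
  rw [h]
  ring

lemma lerchIm_neg_I_div_two_shift (s : ℂ) :
    lerchIm (-Complex.I / 2) s = -(1 / 2) / (1 - s) + 1 / 8 / (3 - s) - 1 / 32 / (5 - s)
      - lerchIm (-Complex.I / 2) (s - 6) / 64 := by
  have h4 : (-Complex.I / 2) ^ 4 = 1 / 16 := by
    linear_combination ((-Complex.I / 2) ^ 2 - 1 / 4) * neg_I_div_two_sq
  have h5 : (-Complex.I / 2) ^ 5 = -Complex.I / 32 := by linear_combination -Complex.I / 2 * h4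
  have h6 : (-Complex.I / 2) ^ 6 = ((-1 / 64 : ℝ) : ℂ) := by
    push_cast
    linear_combination (-Complex.I / 2) ^ 2 * h4 + neg_I_div_two_sq / 16
  have h := lerchIm_eq_sum_add norm_neg_I_div_two_lt_one h6 s
  norm_num [Finset.sum_range_succ, neg_I_div_two_sq, neg_I_div_two_cube, h4, h5, h6] at h
  rw [h]
  ring

lemma two_mul_lerchIm_eq_pochSum_half {c : ℂ} (hc : 1 / 2 < c.re) :
    2 * lerchIm ((1 + Complex.I) / 2) (2 - 2 * c) = pochSum (1 / 2) c c := by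
  refine eq_of_shift_recurrence (q := -1 / 4) (h := 2) (σ := 1 / 2)
    (r := fun s => 1 / (2 * s - 1) + 1 / (2 * s) + 1 / (2 * (2 * s + 1)))
    (f := fun s => 2 * lerchIm ((1 + Complex.I) / 2) (2 - 2 * s))
    (g := fun s => pochSum (1 / 2) s s) (by norm_num) (by norm_num) (fun s _ => ?_)
    (fun s hs => ?_) ?_ ?_ hc
  · rw [lerchIm_one_add_I_div_two_shift]
    simp only [← div_div]
    ring_nf
  · rw [pochSum_half_step hs]
    ring
  · refine (lerchIm_comp_isBigO norm_one_add_I_div_two_lt_one ?_).const_mul_left 2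
    filter_upwards [tendsto_comap.eventually_ge_atTop (1 : ℝ)] with s hs
    simpa using hs
  · refine .of_bound (Real.pi ^ 2 / 3) ?_
    filter_upwards [tendsto_comap.eventually_ge_atTop (3 / 2 : ℝ)] with s hs
    have h := norm_pochSum_le_of_add_one_le_re (x := 1 / 2) (c := s) le_rfl (by linarith)
      (by linarith : 1 ≤ s.re)
    push_cast at h
    rw [Real.norm_eq_abs, abs_of_nonneg (by linarith)]
    nlinarith [sq_nonneg Real.pi]

lemma two_mul_lerchIm_sub_eq_pochSum_two_mul {a : ℂ} (ha : 0 < a.re) :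
    2 * (lerchIm ((1 + Complex.I) / 4) (1 - 2 * a) - lerchIm (-Complex.I / 2) (3 / 2 - 3 * a))
      = pochSum a (2 * a) (3 * a - 1 / 2) := by
  refine eq_of_shift_recurrence (q := -1 / 64) (h := 2) (σ := 0)
    (r := fun s => 1 / (4 * s) + 1 / (4 * (2 * s + 1)) + 1 / (32 * (s + 1))
        + 1 / (3 * s - 1 / 2) - 1 / (4 * (3 * s + 3 / 2)) + 1 / (16 * (3 * s + 7 / 2)))
    (f := fun s => 2 * (lerchIm ((1 + Complex.I) / 4) (1 - 2 * s)
      - lerchIm (-Complex.I / 2) (3 / 2 - 3 * s)))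
    (g := fun s => pochSum s (2 * s) (3 * s - 1 / 2)) (by norm_num) (by norm_num) (fun s _ => ?_)
    (fun s hs => ?_) ?_ ?_ ha
  · rw [lerchIm_one_add_I_div_four_shift, lerchIm_neg_I_div_two_shift,
      show 3 - (1 - 2 * s) = 2 * (s + 1) by ring]
    simp only [← div_div]
    ring_nf
  · rw [pochSum_two_mul_step hs]
    ring
  · refine ((lerchIm_comp_isBigO norm_one_add_I_div_four_lt_one ?_).sub
      (lerchIm_comp_isBigO norm_neg_I_div_two_lt_one ?_)).const_mul_left 2 <;>
    · filter_upwards [tendsto_comap.eventually_ge_atTop (1 : ℝ)] with s hs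
      simpa using (by linarith)
  · refine .of_bound (Real.pi ^ 2 / 3) ?_
    filter_upwards [tendsto_comap.eventually_ge_atTop (1 : ℝ)] with s hs
    have h := norm_pochSum_two_mul_le (d := 3 * s - 1 / 2) hs
      (by simpa using (by linarith : 1 ≤ 3 * s.re - 1 / 2))
    rwa [Real.norm_eq_abs, abs_of_nonneg (by linarith), mul_comm (_ / _)]

lemma hyp3F2Term_one_add_one {a : ℂ} (ha : a ≠ 0) (ha1 : 0 < (a + 1).re) (b e : ℂ) (n : ℕ) :
    hyp3F2Term a b 1 (a + 1) e 1 n = 2 * a * (poch b n / (poch e n * (2 * n + 2 * a))) := by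
  have hn : a + n ≠ 0 := by
    rcases n with _ | n
    · simpa using ha
    · simpa [add_assoc, add_comm (1 : ℂ)] using add_natCast_ne_zero ha1 n
  have hp : poch (a + 1) n ≠ 0 := poch_ne_zero ha1 n
  have hratio : poch a n / poch (a + 1) n = a / (a + n) := by
    rw [div_eq_div_iff hp hn, ← poch_succ, poch_succ_left]
  have hf : (n.factorial : ℂ) ≠ 0 := mod_cast n.factorial_ne_zero
  calc hyp3F2Term a b 1 (a + 1) e 1 n
      = poch a n / poch (a + 1) n * (poch b n / poch e n) * (poch 1 n / n.factorial) := by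
        rw [hyp3F2Term, one_pow]
        simp only [← poch.eq_1]
        ring
    _ = 2 * a * (poch b n / (poch e n * (2 * n + 2 * a))) := by
        rw [hratio, poch_one, div_self hf, ← mul_add, add_comm (n : ℂ)]
        simp only [div_eq_mul_inv, mul_inv]
        ring

lemma summable_hyp3F2Term_one_add_one {a b e : ℂ} (ha : a ≠ 0) (ha1 : 0 < (a + 1).re)
    (hbe : b.re < e.re) : Summable (hyp3F2Term a b 1 (a + 1) e 1) := by
  rw [funext (hyp3F2Term_one_add_one ha ha1 b e)]
  exact (summable_pochSum hbe _).mul_left _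

lemma hyp3F2_one_add_one {a : ℂ} (ha : a ≠ 0) (ha1 : 0 < (a + 1).re) (b e : ℂ) :
    hyp3F2 a b 1 (a + 1) e 1 = 2 * a * pochSum b e (2 * a) := by
  rw [hyp3F2, funext (hyp3F2Term_one_add_one ha ha1 b e), tsum_mul_left, pochSum]

lemma imGen_genF_eq_pochSum {t : ℂ} (ht : t.re < 1 / 2) :
    imGen genF t = t * pochSum (1 / 2) (1 - t) (1 - t) := by
  rw [imGen_genF, ← two_mul_lerchIm_eq_pochSum_half (c := 1 - t)
    (by rw [Complex.sub_re, Complex.one_re]; linarith)]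
  ring_nf

lemma imGen_genG_eq_pochSum {t : ℂ} (ht : t.re < 3 / 2) :
    imGen genG t = t * pochSum (1 / 2 - t / 3) (1 - 2 * t / 3) (1 - t) := by
  have h := two_mul_lerchIm_sub_eq_pochSum_two_mul (a := 1 / 2 - t / 3)
    (by simpa using (by linarith))
  rw [show 1 - 2 * (1 / 2 - t / 3) = 2 * t / 3 by ring,
    show 3 / 2 - 3 * (1 / 2 - t / 3) = t by ring, show 2 * (1 / 2 - t / 3) = 1 - 2 * t / 3 by ring,
    show 3 * (1 / 2 - t / 3) - 1 / 2 = 1 - t by ring] at h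
  rw [imGen_genG, ← h]
  ring

lemma imGen_genF_eq_hyp3F2 {t : ℂ} (ht : t.re < 1 / 2) :
    Summable (hyp3F2Term (1 / 2 - t / 2) (1 / 2) 1 (3 / 2 - t / 2) (1 - t) 1) ∧
      imGen genF t
        = t * (1 - t)⁻¹ * hyp3F2 (1 / 2 - t / 2) (1 / 2) 1 (3 / 2 - t / 2) (1 - t) 1 := by
  have h1 : 1 - t ≠ 0 := Complex.ne_zero_of_re_pos (by simpa using (by linarith))
  have ha : 1 / 2 - t / 2 ≠ 0 := fun h => h1 (by linear_combination 2 * h)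
  have ha1 : 0 < (1 / 2 - t / 2 + 1).re := by
    simpa using (by linarith : 0 < 1 / 2 - t.re / 2 + 1)
  rw [show 3 / 2 - t / 2 = 1 / 2 - t / 2 + 1 by ring]
  have hbe : (1 / 2 : ℂ).re < (1 - t).re := by
    simpa using (by linarith : 1 / 2 < 1 - t.re)
  refine ⟨summable_hyp3F2Term_one_add_one ha ha1 hbe, ?_⟩
  rw [hyp3F2_one_add_one ha ha1, imGen_genF_eq_pochSum ht,
    show 2 * (1 / 2 - t / 2) = 1 - t by ring]
  field_simp

lemma imGen_genG_eq_hyp3F2 {t : ℂ} (ht : t.re < 3 / 2) (ht1 : t ≠ 1) :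
    Summable (hyp3F2Term (1 / 2 - t / 2) (1 / 2 - t / 3) 1 (3 / 2 - t / 2) (1 - 2 * t / 3) 1) ∧
      imGen genG t = t * (1 - t)⁻¹ *
        hyp3F2 (1 / 2 - t / 2) (1 / 2 - t / 3) 1 (3 / 2 - t / 2) (1 - 2 * t / 3) 1 := by
  have h1 : 1 - t ≠ 0 := sub_ne_zero.mpr ht1.symm
  have ha : 1 / 2 - t / 2 ≠ 0 := fun h => h1 (by linear_combination 2 * h)
  have ha1 : 0 < (1 / 2 - t / 2 + 1).re := by
    simpa using (by linarith : 0 < 1 / 2 - t.re / 2 + 1)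
  rw [show 3 / 2 - t / 2 = 1 / 2 - t / 2 + 1 by ring]
  have hbe : (1 / 2 - t / 3).re < (1 - 2 * t / 3).re := by
    simpa using (by linarith : 1 / 2 - t.re / 3 < 1 - 2 * t.re / 3)
  refine ⟨summable_hyp3F2Term_one_add_one ha ha1 hbe, ?_⟩
  rw [hyp3F2_one_add_one ha ha1, imGen_genG_eq_pochSum ht,
    show 2 * (1 / 2 - t / 2) = 1 - t by ring]
  field_simp

lemma B_add_I_mul_F (n : ℕ) : (B (n + 1) : ℂ) + Complex.I * F (n + 1)
    = 2 ^ n * polylog (n + 1) ((1 + Complex.I) / 2) := by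
  rw [B, F, mul_comm Complex.I, Complex.re_add_im]
  simp

lemma D_add_I_mul_G (n : ℕ) : (D (n + 1) : ℂ) + Complex.I * G (n + 1)
    = (2 / 3) ^ n * polylog (n + 1) ((1 + Complex.I) / 4)
      - polylog (n + 1) (-Complex.I / 2) := by
  rw [D, G, mul_comm Complex.I, Complex.re_add_im]
  simp

lemma hasSum_genF {t : ℂ} (ht : ‖t‖ < 1 / 2) :
    HasSum (fun n : ℕ => 2 * ((B (n + 1) : ℂ) + Complex.I * (F (n + 1) : ℂ)) * t ^ (n + 1))
      (genF t) := by
  have hs : ‖2 * t‖ < 1 := by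
    rw [norm_mul, Complex.norm_ofNat]
    linarith
  rw [genF_eq]
  convert! (hasSum_polylog_mul_pow norm_one_add_I_div_two_lt_one hs).mul_left (2 * t) using 1
  funext n
  rw [B_add_I_mul_F, mul_pow]
  ring

lemma hasSum_genG {t : ℂ} (ht : ‖t‖ < 1) :
    HasSum (fun n : ℕ => 2 * ((D (n + 1) : ℂ) + Complex.I * (G (n + 1) : ℂ)) * t ^ (n + 1))
      (genG t) := by
  have hs : ‖2 * t / 3‖ < 1 := by
    rw [norm_div, norm_mul, Complex.norm_ofNat, Complex.norm_ofNat]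
    linarith [norm_nonneg t]
  rw [genG_eq]
  convert! ((hasSum_polylog_mul_pow norm_one_add_I_div_four_lt_one hs).sub
    (hasSum_polylog_mul_pow norm_neg_I_div_two_lt_one ht)).mul_left (2 * t) using 1
  funext n
  rw [D_add_I_mul_G, mul_div_right_comm, mul_pow]
  ring

lemma polylog_one_eq_neg_log {z : ℂ} (hz : ‖z‖ < 1) : polylog 1 z = -Complex.log (1 - z) := by
  have h := ((hasSum_nat_add_iff' 1).mpr (Complex.hasSum_taylorSeries_neg_log hz)).tsum_eq
  simpa [polylog] using h

lemma polylog_one_im {z : ℂ} (hz : ‖z‖ < 1) :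
    (polylog 1 z).im = Real.arctan (z.im / (1 - z.re)) := by
  have hre : 0 < (1 - z).re := by
    rw [Complex.sub_re, Complex.one_re]
    linarith [Complex.re_le_norm z]
  have harg := abs_lt.mp (Complex.abs_arg_lt_pi_div_two_iff.mpr (Or.inl hre))
  rw [polylog_one_eq_neg_log hz, Complex.neg_im, Complex.log_im,
    ← Real.arctan_tan harg.1 harg.2, Complex.tan_arg, ← Real.arctan_neg, ← neg_div]
  simp

lemma lerchIm_zero {z : ℂ} (hz : ‖z‖ < 1) : lerchIm z 0 = (polylog 1 z).im := by
  have hpoly : lerch z 0 = polylog 1 z := by simp [lerch, poleSum, polylog]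
  have h := lerch_sub_conj hz 0
  rw [map_zero, hpoly, Complex.sub_conj, Complex.ofReal_mul, Complex.ofReal_ofNat] at h
  exact mul_left_cancel₀ two_mul_I_ne_zero (by linear_combination -h)

lemma F_one_eq_polylog_im : F 1 = (polylog 1 ((1 + Complex.I) / 2)).im := by
  simp [F]

lemma F_one : F 1 = Real.pi / 4 := by
  rw [F_one_eq_polylog_im, polylog_one_im norm_one_add_I_div_two_lt_one, ← Real.arctan_one]
  norm_num

lemma G_one : G 1 = Real.pi / 4 := by
  have h : G 1 = (polylog 1 ((1 + Complex.I) / 4)).im - (polylog 1 (-Complex.I / 2)).im := by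
    simp [G]
  rw [h, polylog_one_im norm_one_add_I_div_four_lt_one, polylog_one_im norm_neg_I_div_two_lt_one,
    ← Real.arctan_inv_2_add_arctan_inv_3, sub_eq_add_neg, ← Real.arctan_neg, add_comm]
  norm_num

lemma pochSum_half_one_one : pochSum (1 / 2) 1 1 = (Real.pi / 2 : ℝ) := by
  rw [← two_mul_lerchIm_eq_pochSum_half (by norm_num), mul_one, sub_self,
    lerchIm_zero norm_one_add_I_div_two_lt_one, ← F_one_eq_polylog_im, F_one]
  push_cast
  ring

/-- The normalized central binomial coefficient `binom (2 n) n / 4 ^ n`, which is the coefficient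
of `x ^ n` in `(1 - x) ^ (-1 / 2)`. -/
def cbin (n : ℕ) : ℝ := n.centralBinom / 4 ^ n

lemma cbin_zero : cbin 0 = 1 := by simp [cbin]

lemma cbin_pos (n : ℕ) : 0 < cbin n :=
  div_pos (Nat.cast_pos.mpr n.centralBinom_pos) (by positivity)

lemma cbin_succ (n : ℕ) : cbin (n + 1) = cbin n * (2 * n + 1) / (2 * n + 2) := by
  have h : ((n : ℝ) + 1) * (n + 1).centralBinom = 2 * (2 * n + 1) * n.centralBinom :=
    mod_cast n.succ_mul_centralBinom_succ
  rw [cbin, cbin, pow_succ, div_mul_eq_mul_div, div_div,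
    div_eq_div_iff (by positivity) (by positivity)]
  linear_combination 2 * 4 ^ n * h

lemma cbin_eq_poch_div_poch (n : ℕ) : (cbin n : ℂ) = poch (1 / 2) n / poch 1 n := by
  induction n with
  | zero => simp [cbin_zero, poch_zero]
  | succ n ih =>
    rw [cbin_succ, poch_succ, poch_succ, mul_div_mul_comm, ← ih]
    push_cast
    rw [mul_div_assoc, show 2 * (n : ℂ) + 2 = 2 * (1 + n) by ring,
      show 2 * (n : ℂ) + 1 = 2 * (1 / 2 + n) by ring, mul_div_mul_left _ _ two_ne_zero]

lemma tendsto_cbin : Tendsto cbin atTop (𝓝 0) := by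
  have h := tendsto_poch_div_poch (a := 1 / 2) (c := 1) (by norm_num)
  simp only [← cbin_eq_poch_div_poch] at h
  simpa [Function.comp_def] using (Complex.continuous_re.tendsto 0).comp h

lemma cbin_div_eq (n : ℕ) (x : ℝ) : ((cbin n / (2 * n + 1 + x) : ℝ) : ℂ)
    = poch (1 / 2) n / (poch 1 n * (2 * n + (1 + x))) := by
  push_cast
  rw [cbin_eq_poch_div_poch, div_div, add_assoc]

/-- The series `∑ binom (2 n) n / (4 ^ n (2 n + 1 + x))`, the term-by-term form of Wallis' integral
`∫ sin ^ x` over `[0, π / 2]`. -/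
def wallis (x : ℝ) : ℝ := ∑' n : ℕ, cbin n / (2 * n + 1 + x)

/-- The series `∑ binom (2 n) n / (4 ^ n (2 n + 1 + x) ^ 2)`, which is the derivative of
`-wallis` at `x`. -/
def wallisSq (x : ℝ) : ℝ := ∑' n : ℕ, cbin n / (2 * n + 1 + x) ^ 2

lemma hasSum_wallis (x : ℝ) : HasSum (fun n : ℕ => cbin n / (2 * n + 1 + x)) (wallis x) := by
  refine (Complex.summable_ofReal.mp ?_).hasSum
  simp only [cbin_div_eq]
  exact summable_pochSum (by norm_num) _

lemma ofReal_wallis (x : ℝ) : (wallis x : ℂ) = pochSum (1 / 2) 1 (1 + x) := by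
  rw [wallis, Complex.ofReal_tsum, pochSum]
  exact tsum_congr fun n => cbin_div_eq n x

section wallis

variable {x : ℝ}

lemma cbin_div_sq_le (hx : 0 ≤ x) (n : ℕ) :
    cbin n / (2 * n + 1 + x) ^ 2 ≤ cbin n / (2 * n + 1 + x) / (x + 1) := by
  rw [div_div, sq]
  refine div_le_div_of_nonneg_left (cbin_pos n).le (by positivity)
    (mul_le_mul_of_nonneg_left ?_ (by positivity))
  linarith [(n.cast_nonneg : (0 : ℝ) ≤ n)]

lemma hasSum_wallisSq (hx : 0 ≤ x) :
    HasSum (fun n : ℕ => cbin n / (2 * n + 1 + x) ^ 2) (wallisSq x) :=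
  (Summable.of_nonneg_of_le (fun n => div_nonneg (cbin_pos n).le (sq_nonneg _))
    (cbin_div_sq_le hx) ((hasSum_wallis x).div_const (x + 1)).summable).hasSum

lemma wallis_pos (hx : 0 ≤ x) : 0 < wallis x :=
  (hasSum_wallis x).summable.tsum_pos (fun n => div_nonneg (cbin_pos n).le (by positivity)) 0
    (div_pos (cbin_pos 0) (by positivity))

lemma wallisSq_nonneg (x : ℝ) : 0 ≤ wallisSq x :=
  tsum_nonneg fun n => div_nonneg (cbin_pos n).le (sq_nonneg _)

lemma wallisSq_le (hx : 0 ≤ x) : wallisSq x ≤ wallis x / (x + 1) :=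
  hasSum_le (cbin_div_sq_le hx) (hasSum_wallisSq hx) ((hasSum_wallis x).div_const (x + 1))

lemma tendsto_mul_cbin_div (hx : 0 ≤ x) :
    Tendsto (fun n : ℕ => 2 * n * cbin n / (2 * n + 1 + x)) atTop (𝓝 0) := by
  refine squeeze_zero (fun n => ?_) (fun n => ?_) tendsto_cbin
  · have := cbin_pos n
    positivity
  · rw [div_le_iff₀ (by positivity), mul_comm]
    gcongr
    · exact (cbin_pos n).le
    · linarith

lemma tendsto_mul_cbin_div_sq (hx : 0 ≤ x) :
    Tendsto (fun n : ℕ => 2 * n * cbin n / (2 * n + 1 + x) ^ 2) atTop (𝓝 0) := by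
  refine squeeze_zero (fun n => ?_) (fun n => ?_) (tendsto_mul_cbin_div hx)
  all_goals have := cbin_pos n
  · positivity
  · refine div_le_div_of_nonneg_left (by positivity) (by positivity)
      (le_self_pow₀ ?_ two_ne_zero)
    linarith [(n.cast_nonneg : (0 : ℝ) ≤ n)]

lemma wallis_add_two (hx : 0 ≤ x) : (x + 1) * wallis x = (x + 2) * wallis (x + 2) := by
  have h := ((hasSum_wallis (x + 2)).mul_left (x + 2)).sub ((hasSum_wallis x).mul_left (x + 1))
  have htel := hasSum_of_telescoping (T := fun n : ℕ => 2 * n * cbin n / (2 * n + 1 + x))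
    h.summable (fun n => ?_) (tendsto_mul_cbin_div hx)
  · have := h.unique htel
    rw [Nat.cast_zero, mul_zero, zero_mul, zero_div] at this
    linarith
  · have h1 : 2 * (n : ℝ) + 1 + x ≠ 0 := by positivity
    have h2 : 2 * (n : ℝ) + 3 + x ≠ 0 := by positivity
    rw [cbin_succ, Nat.cast_succ, show 2 * (n : ℝ) + 1 + (x + 2) = 2 * n + 3 + x by ring,
      show 2 * ((n : ℝ) + 1) + 1 + x = 2 * n + 3 + x by ring]
    field_simp
    ring

lemma wallisSq_add_two (hx : 0 ≤ x) : wallis x - (x + 1) * wallisSq x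
    = wallis (x + 2) - (x + 2) * wallisSq (x + 2) := by
  have h := ((hasSum_wallis x).sub ((hasSum_wallisSq hx).mul_left (x + 1))).sub
    ((hasSum_wallis (x + 2)).sub
      ((hasSum_wallisSq (add_nonneg hx zero_le_two)).mul_left (x + 2)))
  have htel := hasSum_of_telescoping (T := fun n : ℕ => 2 * n * cbin n / (2 * n + 1 + x) ^ 2)
    h.summable (fun n => ?_) (tendsto_mul_cbin_div_sq hx)
  · have := h.unique htel
    rw [Nat.cast_zero, mul_zero, zero_mul, zero_div] at this
    linarith
  · have h1 : 2 * (n : ℝ) + 1 + x ≠ 0 := by positivity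
    have h2 : 2 * (n : ℝ) + 3 + x ≠ 0 := by positivity
    rw [cbin_succ, Nat.cast_succ, show 2 * (n : ℝ) + 1 + (x + 2) = 2 * n + 3 + x by ring,
      show 2 * ((n : ℝ) + 1) + 1 + x = 2 * n + 3 + x by ring]
    field_simp
    ring

lemma wallisSq_div_wallis_add_two (hx : 0 ≤ x) :
    wallisSq x / wallis x - 1 / (x + 1)
      = wallisSq (x + 2) / wallis (x + 2) - 1 / (x + 2) := by
  have h1 := wallis_pos hx
  have h2 := wallis_pos (x := x + 2) (by linarith)
  have h3 : x + 1 ≠ 0 := by positivity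
  have h4 : x + 2 ≠ 0 := by positivity
  calc wallisSq x / wallis x - 1 / (x + 1)
      = -(wallis x - (x + 1) * wallisSq x) / ((x + 1) * wallis x) := by field_simp; ring
    _ = -(wallis (x + 2) - (x + 2) * wallisSq (x + 2)) / ((x + 2) * wallis (x + 2)) := by
      rw [wallis_add_two hx, wallisSq_add_two hx]
    _ = wallisSq (x + 2) / wallis (x + 2) - 1 / (x + 2) := by field_simp; ring

-- The logarithmic derivative of `wallis x * wallis (x + 1) = π / (2 * (x + 1))`.
lemma wallisSq_div_wallis_add_one (hx : 0 ≤ x) :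
    wallisSq x / wallis x + wallisSq (x + 1) / wallis (x + 1) = 1 / (x + 1) := by
  let q : ℕ → ℝ := fun k => wallisSq (x + k) / wallis (x + k)
  have hxk : ∀ k : ℕ, 0 ≤ x + k := fun k => add_nonneg hx k.cast_nonneg
  have hinv : Tendsto (fun k : ℕ => 1 / (x + k + 1)) atTop (𝓝 0) := by
    simp_rw [one_div]
    exact ((tendsto_atTop_add_const_left _ x tendsto_natCast_atTop_atTop).atTop_add
      tendsto_const_nhds).inv_tendsto_atTop
  have hq : Tendsto q atTop (𝓝 0) := by
    refine squeeze_zero (fun k => div_nonneg (wallisSq_nonneg _) (wallis_pos (hxk k)).le)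
      (fun k => ?_) hinv
    rw [div_le_iff₀ (wallis_pos (hxk k)), one_div_mul_eq_div]
    exact wallisSq_le (hxk k)
  have hconst : ∀ k, q k + q (k + 1) - 1 / (x + k + 1) = q 0 + q 1 - 1 / (x + 1) := fun k => by
    induction k with
    | zero => simp
    | succ k ih =>
      have hstep : q k - 1 / (x + k + 1) = q (k + 2) - 1 / (x + k + 2) := by
        simpa [q, add_assoc] using wallisSq_div_wallis_add_two (hxk k)
      rw [← ih, Nat.cast_succ, ← add_assoc x, add_assoc _ (1 : ℝ) 1, one_add_one_eq_two]
      linarith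
  have hlim := (hq.add (hq.comp (tendsto_add_atTop_nat 1))).sub hinv
  simp only [Function.comp_def, hconst, add_zero, sub_zero] at hlim
  simpa [q, sub_eq_zero] using tendsto_nhds_unique tendsto_const_nhds hlim

end wallis

lemma wallis_zero : wallis 0 = Real.pi / 2 := by
  have h := ofReal_wallis 0
  rw [Complex.ofReal_zero, add_zero, pochSum_half_one_one] at h
  exact_mod_cast h

lemma wallis_one : wallis 1 = 1 := by
  refine (hasSum_of_telescoping (hasSum_wallis 1).summable
    (fun n => ?_) tendsto_cbin).tsum_eq.trans cbin_zero
  rw [cbin_succ]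
  field_simp
  ring

lemma wallisSq_zero : wallisSq 0 = Real.pi / 2 * (1 - wallisSq 1) := by
  have h := wallisSq_div_wallis_add_one le_rfl
  rw [zero_add, wallis_zero, wallis_one, div_one, div_one] at h
  rw [← eq_sub_iff_add_eq.mpr h, mul_div_cancel₀ _ (by positivity)]

lemma wallis_two_mul (j : ℕ) : wallis (2 * j) = Real.pi / 2 * cbin j := by
  induction j with
  | zero => simp [wallis_zero, cbin_zero]
  | succ j ih =>
    have h := wallis_add_two (x := 2 * j) (by positivity)
    rw [ih] at h
    rw [Nat.cast_succ, mul_add_one, eq_div_of_mul_eq (by positivity) ((mul_comm _ _).trans h.symm),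
      cbin_succ]
    ring

lemma wallis_two_mul_add_one (j : ℕ) :
    (wallis (2 * j + 1) : ℂ) = poch 1 j / poch (3 / 2) j := by
  induction j with
  | zero => simp [wallis_one, poch_zero]
  | succ j ih =>
    have h := congrArg Complex.ofReal (wallis_add_two (x := 2 * j + 1) (by positivity))
    have h1 := poch_ne_zero (a := 3 / 2) (by norm_num) j
    have h2 : 3 / 2 + (j : ℂ) ≠ 0 := add_natCast_ne_zero (by norm_num) j
    rw [Complex.ofReal_mul, Complex.ofReal_mul, ih] at h
    rw [poch_succ, poch_succ, eq_div_iff (mul_ne_zero h1 h2), Nat.cast_succ, mul_add_one,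
      add_right_comm (2 * (j : ℝ)) 2 1]
    field_simp at h
    push_cast at h ⊢
    linear_combination -h / 2

lemma pochSum_one_telescoping {s : ℂ} (hs : 0 < s.re) (n : ℕ) :
    poch 1 (n + 1) / (poch (s + 1) (n + 1) * (2 * (n + 1 : ℕ) + 2 * s)) / s
        + poch 1 n / (poch (s + 1 + 1) n * (2 * n + 2 * (s + 1))) / (s + 1)
      = 1 / (2 * s ^ 2) * (poch 1 n / poch (s + 1) n)
        - 1 / (2 * s ^ 2) * (poch 1 (n + 1) / poch (s + 1) (n + 1)) := by
  have hs0 : s ≠ 0 := Complex.ne_zero_of_re_pos hs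
  have hs1 : 0 < (s + 1).re := add_pos hs one_pos
  have hs10 : s + 1 ≠ 0 := Complex.ne_zero_of_re_pos hs1
  have hQ := poch_ne_zero hs1 n
  have hn := add_natCast_ne_zero hs1 n
  have hshift : poch (s + 1 + 1) n = poch (s + 1) n * (s + 1 + n) / (s + 1) := by
    rw [eq_div_iff hs10, ← poch_succ, poch_succ_left, mul_comm]
  rw [hshift, poch_succ, poch_succ]
  push_cast
  rw [show 2 * ((n : ℂ) + 1) + 2 * s = 2 * (s + 1 + n) by ring,
    show 2 * (n : ℂ) + 2 * (s + 1) = 2 * (s + 1 + n) by ring]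
  field_simp
  ring

lemma pochSum_one_step {s : ℂ} (hs : 0 < s.re) :
    pochSum 1 (s + 1) (2 * s) / s = 1 / s ^ 2 - pochSum 1 (s + 1 + 1) (2 * (s + 1)) / (s + 1) := by
  have hs1 : (1 : ℂ).re < (s + 1).re := lt_add_of_pos_left _ hs
  have hS := summable_pochSum hs1 (2 * s)
  have hu := ((summable_nat_add_iff 1).mpr hS).div_const s
  have hs2 : (1 : ℂ).re < (s + 1 + 1).re := hs1.trans (lt_add_one _)
  have hv := (summable_pochSum hs2 (2 * (s + 1))).div_const (s + 1)
  have htel := hasSum_of_telescoping (hu.add hv) (pochSum_one_telescoping hs) <| by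
    simpa only [mul_zero] using (tendsto_poch_div_poch hs1).const_mul (1 / (2 * s ^ 2))
  have h := htel.tsum_eq
  rw [hu.tsum_add hv, tsum_div_const, tsum_div_const, ← pochSum] at h
  have h0 := hS.tsum_eq_zero_add
  simp only [poch_zero, Nat.cast_zero, mul_zero, zero_add, one_mul, div_one, mul_one] at h h0
  have hhead : 1 / (2 * s) / s = 1 / s ^ 2 - 1 / (2 * s ^ 2) := by
    have hs0 : s ≠ 0 := Complex.ne_zero_of_re_pos hs
    field_simp
    norm_num
  rw [pochSum, h0]
  linear_combination h + hhead

lemma summable_neg_one_pow_div_sq (s : ℂ) :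
    Summable fun k : ℕ => (-1 : ℂ) ^ k / ((k : ℂ) + s) ^ 2 := by
  refine summable_of_isBigO_nat (g := fun k : ℕ => ((k : ℝ) ^ 2)⁻¹)
    (Real.summable_nat_pow_inv.mpr one_lt_two) (IsBigO.of_norm_left ?_)
  simpa [div_eq_mul_inv] using ((inv_natCast_add_isBigO s).pow 2).norm_left

lemma hasSum_neg_one_pow_div_sq {s : ℂ} (hs : 0 < s.re) :
    HasSum (fun k : ℕ => (-1 : ℂ) ^ k / ((k : ℂ) + s) ^ 2) (pochSum 1 (s + 1) (2 * s) / s) := by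
  let Y : ℕ → ℂ := fun k => pochSum 1 (k + s + 1) (2 * (k + s)) / (k + s)
  have hre (k : ℕ) : ((k : ℂ) + s).re = k + s.re := by simp
  have hY : Tendsto (fun k : ℕ => (-1 : ℂ) ^ k * Y k) atTop (𝓝 0) := by
    have hpoch : (fun k : ℕ => (-1 : ℂ) ^ k * pochSum 1 (k + s + 1) (2 * (k + s)))
        =O[atTop] fun _ => (1 : ℝ) := by
      refine IsBigO.of_bound (1 * (Real.pi ^ 2 / 3)) ?_
      filter_upwards [eventually_ge_atTop 1] with k hk
      have hk : (1 : ℝ) ≤ k := mod_cast hk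
      have h := norm_pochSum_le_of_add_one_le_re (x := 1) (c := k + s + 1) (d := 2 * (k + s))
        (by norm_num) (by simpa using (by linarith : 1 ≤ k + s.re))
        (by simpa using (by linarith : 1 ≤ 2 * (k + s.re)))
      simpa using h
    refine (hpoch.mul (inv_natCast_add_isBigO s)).trans_tendsto ?_ |>.congr fun k => ?_
    · simpa using tendsto_inv_atTop_nhds_zero_nat (𝕜 := ℝ)
    · rw [mul_assoc, ← div_eq_mul_inv]
  convert! hasSum_of_telescoping (summable_neg_one_pow_div_sq s) (fun k => ?_) hY using 1
  · simp [Y]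
  · have h := pochSum_one_step (s := k + s) (by rw [hre]; positivity)
    simp only [Y]
    rw [h, pow_succ, Nat.cast_succ, add_right_comm (k : ℂ) 1 s]
    ring

lemma pochSum_one_three_halves_one : pochSum 1 (3 / 2) 1 = (2 * catalanConst : ℝ) := by
  have h := (hasSum_neg_one_pow_div_sq (s := 1 / 2) (by norm_num)).div_const 2
  have hhalf : pochSum 1 (1 / 2 + 1) (2 * (1 / 2)) / (1 / 2) / 2 = pochSum 1 (3 / 2) 1 := by
    ring_nf
  rw [← hhalf, ← h.tsum_eq, catalanConst, ← tsum_mul_left, Complex.ofReal_tsum]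
  refine tsum_congr fun k => ?_
  have : 2 * (k : ℂ) + 1 ≠ 0 := two_mul_natCast_add_ne_zero (by norm_num) k
  push_cast
  rw [show (k : ℂ) + 1 / 2 = (2 * k + 1) / 2 by ring]
  field_simp

lemma hasSum_wallis_odd :
    HasSum (fun j : ℕ => wallis (2 * j + 1) / (2 * j + 1)) (2 * catalanConst) := by
  refine Complex.hasSum_ofReal.mp ?_
  rw [← pochSum_one_three_halves_one]
  convert! (summable_pochSum (a := 1) (c := 3 / 2) (by norm_num) 1).hasSum using 1
  funext j
  rw [← div_div, ← wallis_two_mul_add_one]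
  push_cast
  rfl

lemma hasSum_wallis_even :
    HasSum (fun j : ℕ => wallis (2 * j + 2) / (2 * j + 2)) (wallisSq 0) := by
  have h := ((hasSum_wallis 1).sub (hasSum_wallisSq zero_le_one)).mul_left (Real.pi / 2)
  rw [wallis_one, ← wallisSq_zero] at h
  convert! h using 1
  funext j
  have hwallis : wallis (2 * j + 2) = Real.pi / 2 * cbin (j + 1) := by
    rw [← wallis_two_mul, Nat.cast_succ, mul_add_one]
  rw [hwallis, cbin_succ, add_assoc (2 * (j : ℝ)) 1 1, one_add_one_eq_two]
  field_simp
  ring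

lemma hasSum_wallis_add_one_div :
    HasSum (fun k : ℕ => wallis (k + 1) / (k + 1)) (2 * catalanConst + wallisSq 0) := by
  refine HasSum.even_add_odd ?_ ?_
  · simpa using hasSum_wallis_odd
  · simpa [add_assoc, one_add_one_eq_two] using hasSum_wallis_even

lemma hasSum_harmonic (N : ℕ) :
    HasSum (fun k : ℕ => 1 / ((k : ℝ) + 1) - 1 / (k + 1 + N)) (harmonic N : ℝ) := by
  let T : ℕ → ℝ := fun k => ∑ i ∈ Finset.range N, 1 / ((k : ℝ) + i + 1)
  have hT : Tendsto T atTop (𝓝 0) := by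
    have h (i : ℕ) : Tendsto (fun k : ℕ => 1 / ((k : ℝ) + i + 1)) atTop (𝓝 0) := by
      simpa [Function.comp_def] using
        (tendsto_one_div_add_atTop_nhds_zero_nat (𝕜 := ℝ)).comp (tendsto_add_atTop_nat i)
    simpa [T] using tendsto_finsetSum (Finset.range N) fun i _ => h i
  have hstep (k : ℕ) : 1 / ((k : ℝ) + 1) - 1 / (k + 1 + N) = T k - T (k + 1) := by
    have hcast (i : ℕ) : ((k + 1 : ℕ) : ℝ) + i + 1 = k + (i + 1 : ℕ) + 1 := by push_cast; ring
    simp only [T, hcast, ← Finset.sum_sub_distrib]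
    rw [Finset.sum_range_sub' fun i : ℕ => 1 / ((k : ℝ) + i + 1)]
    simp [add_right_comm]
  have hT0 : T 0 = harmonic N := by simp [T, harmonic]
  rw [hasSum_iff_tendsto_nat_of_nonneg, ← hT0]
  · simp_rw [hstep, Finset.sum_range_sub']
    simpa using hT.const_sub (T 0)
  · intro k
    exact sub_nonneg.mpr (one_div_le_one_div_of_le (by positivity) (by simp))

lemma hasSum_cbin_mul_harmonic_succ :
    HasSum (fun n : ℕ => cbin n / (2 * n + 1) * (harmonic (2 * n + 1) : ℝ))
      (2 * catalanConst + wallisSq 0) := by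
  let f : ℕ × ℕ → ℝ := fun p => cbin p.2 / (2 * p.2 + 1 + (p.1 + 1)) / (p.1 + 1)
  have hrow (k : ℕ) : HasSum (fun n => f (k, n)) (wallis (k + 1) / (k + 1)) :=
    (hasSum_wallis (k + 1)).div_const (k + 1 : ℝ)
  have hcol (n : ℕ) :
      HasSum (fun k => f (k, n)) (cbin n / (2 * n + 1) * (harmonic (2 * n + 1) : ℝ)) := by
    convert! (hasSum_harmonic (2 * n + 1)).mul_left (cbin n / (2 * n + 1)) using 1
    funext k
    simp only [f]
    push_cast
    field_simp
    ring
  have hnonneg : 0 ≤ f := fun p =>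
    div_nonneg (div_nonneg (cbin_pos _).le (by positivity)) (by positivity)
  have hf : Summable f := by
    rw [summable_prod_of_nonneg hnonneg, funext fun k => (hrow k).tsum_eq]
    exact ⟨fun k => (hrow k).summable, hasSum_wallis_add_one_div.summable⟩
  rw [← (hf.hasSum.prod_fiberwise hrow).unique hasSum_wallis_add_one_div]
  exact ((Equiv.prodComm ℕ ℕ).hasSum_iff.mpr hf.hasSum).prod_fiberwise hcol

lemma hasSum_cbin_mul_harmonic :
    HasSum (fun n : ℕ => cbin n / (2 * n + 1) * (harmonic (2 * n) : ℝ)) (2 * catalanConst) := by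
  have h := hasSum_cbin_mul_harmonic_succ.sub (hasSum_wallisSq le_rfl)
  rw [add_sub_cancel_right] at h
  convert! h using 1
  funext n
  rw [harmonic_succ]
  push_cast
  rw [add_zero]
  field_simp
  ring

lemma hasSum_catalanConst :
    HasSum (fun n : ℕ => (1 / 2 : ℝ) ^ (2 * (n + 1) + 1) / (2 * ((n : ℝ) + 1) + 1)
      * ((2 * (n + 1)).choose (n + 1) : ℝ) * (harmonic (2 * (n + 1)) : ℝ)) catalanConst := by
  have h := ((hasSum_nat_add_iff' 1).mpr hasSum_cbin_mul_harmonic).div_const 2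
  simp only [Finset.range_one, Finset.sum_singleton, mul_zero, harmonic_zero, Rat.cast_zero,
    sub_zero, mul_div_cancel_left₀ _ (two_ne_zero (α := ℝ))] at h
  convert! h using 1
  funext n
  have hpow : (1 / 2 : ℝ) ^ (2 * (n + 1) + 1) = 1 / (4 ^ (n + 1) * 2) := by
    rw [one_div_pow, pow_succ, pow_mul]
    norm_num
  rw [cbin, Nat.centralBinom_eq_two_mul_choose, hpow]
  push_cast
  field_simp

lemma ordinaryHypergeometric_half :
    ordinaryHypergeometric (1 / 2 : ℝ) (1 / 2) (3 / 2) (1 : ℝ) = Real.pi / 2 := by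
  have hcast (x : ℝ) (n : ℕ) : (((ascPochhammer ℝ n).eval x : ℝ) : ℂ) = poch x n := by
    rw [poch, ascPochhammer_eval₂ Complex.ofRealHom]
    exact (Polynomial.eval₂_hom Complex.ofRealHom x).symm
  rw [ordinaryHypergeometric_eq_tsum, ← wallis_zero, wallis]
  refine tsum_congr fun n => ?_
  have h0 := poch_ne_zero (a := 1 / 2) (by norm_num) n
  have h1 := poch_ne_zero (a := 1) (by norm_num) n
  have hn : 2 * (n : ℂ) + 1 ≠ 0 := two_mul_natCast_add_ne_zero (by norm_num) n
  have h3 : poch (3 / 2) n = poch (1 / 2) n * (2 * n + 1) := by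
    have := (poch_succ_left (1 / 2) n).symm.trans (poch_succ (1 / 2) n)
    rw [show (1 / 2 : ℂ) + 1 = 3 / 2 by norm_num] at this
    linear_combination 2 * this
  rw [← Complex.ofReal_inj, cbin_div_eq]
  simp only [one_pow, smul_eq_mul, mul_one]
  push_cast
  rw [hcast, hcast]
  push_cast
  rw [← poch_one, h3, add_zero]
  field_simp

end Ladder

end

theorem mainTheorem8 :
    -- the generators `F(t)`, `G(t)` of the ladders, near `t = 0`
    (∀ t : ℂ, ‖t‖ < 1 / 2 →
      HasSum (fun n : ℕ => 2 * ((Ladder.B (n + 1) : ℂ) + Complex.I * (Ladder.F (n + 1) : ℂ))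
        * t ^ (n + 1)) (Ladder.genF t)) ∧
    (∀ t : ℂ, ‖t‖ < 1 →
      HasSum (fun n : ℕ => 2 * ((Ladder.D (n + 1) : ℂ) + Complex.I * (Ladder.G (n + 1) : ℂ))
        * t ^ (n + 1)) (Ladder.genG t)) ∧
    -- the shift recurrences, at every `t` where all terms are defined
    (∀ t : ℂ, (∀ k : ℕ, 2 * t ≠ k) →
      2 * Ladder.genF t / t - (Complex.I * Ladder.genF (t - 1) - Complex.I) / (t - 1)
        = (2 + 2 * Complex.I) / (1 - 2 * t)) ∧
    (∀ t : ℂ, (∀ k : ℕ, t ≠ k ∧ 2 * t ≠ 3 * k) →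
      2 ^ 3 * Ladder.genG t / t - (Complex.I * Ladder.genG (t - 3) - Complex.I) / (t - 3)
        = (12 + 12 * Complex.I) / (3 - 2 * t) + 8 * Complex.I / (1 - t) + 4 / (2 - t)) ∧
    -- the hypergeometric form of `Im F(t)`, on the half-plane of convergence
    (∀ t : ℂ, t.re < 1 / 2 →
      Summable (Ladder.hyp3F2Term (1 / 2 - t / 2) (1 / 2) 1 (3 / 2 - t / 2) (1 - t) 1) ∧
      Ladder.imGen Ladder.genF t
        = t * (1 - t)⁻¹ * Ladder.hyp3F2 (1 / 2 - t / 2) (1 / 2) 1 (3 / 2 - t / 2) (1 - t) 1) ∧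
    -- the same as a power series in `t`
    (∀ t : ℂ, ‖t‖ < 1 / 2 →
      HasSum (fun n : ℕ => 2 * (Ladder.F (n + 1) : ℂ) * t ^ (n + 1))
        (t * (1 - t)⁻¹ * Ladder.hyp3F2 (1 / 2 - t / 2) (1 / 2) 1 (3 / 2 - t / 2) (1 - t) 1)) ∧
    -- the hypergeometric form of `Im G(t)`, on the half-plane of convergence
    (∀ t : ℂ, t.re < 3 / 2 → t ≠ 1 →
      Summable (Ladder.hyp3F2Term
        (1 / 2 - t / 2) (1 / 2 - t / 3) 1 (3 / 2 - t / 2) (1 - 2 * t / 3) 1) ∧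
      Ladder.imGen Ladder.genG t
        = t * (1 - t)⁻¹ * Ladder.hyp3F2
            (1 / 2 - t / 2) (1 / 2 - t / 3) 1 (3 / 2 - t / 2) (1 - 2 * t / 3) 1) ∧
    -- the same as a power series in `t`
    (∀ t : ℂ, ‖t‖ < 1 →
      HasSum (fun n : ℕ => 2 * (Ladder.G (n + 1) : ℂ) * t ^ (n + 1))
        (t * (1 - t)⁻¹ * Ladder.hyp3F2
          (1 / 2 - t / 2) (1 / 2 - t / 3) 1 (3 / 2 - t / 2) (1 - 2 * t / 3) 1)) ∧
    -- the terms of order `t`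
    (2 * Ladder.F 1 = ordinaryHypergeometric (1 / 2 : ℝ) (1 / 2) (3 / 2) (1 : ℝ) ∧
      2 * Ladder.G 1 = ordinaryHypergeometric (1 / 2 : ℝ) (1 / 2) (3 / 2) (1 : ℝ) ∧
      ordinaryHypergeometric (1 / 2 : ℝ) (1 / 2) (3 / 2) (1 : ℝ) = Real.pi / 2) ∧
    -- the series for Catalan's constant, summed over `n + 1 = 1, 2, …`
    HasSum (fun n : ℕ => (1 / 2 : ℝ) ^ (2 * (n + 1) + 1) / (2 * ((n : ℝ) + 1) + 1)
      * ((2 * (n + 1)).choose (n + 1) : ℝ) * (harmonic (2 * (n + 1)) : ℝ))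
      Ladder.catalanConst := by
  open Ladder in
  refine ⟨fun t ht => hasSum_genF ht, fun t ht => hasSum_genG ht, fun t ht => genF_shift ht,
    fun t ht => genG_shift ht, fun t ht => imGen_genF_eq_hyp3F2 ht, fun t ht => ?_,
    fun t ht ht1 => imGen_genG_eq_hyp3F2 ht ht1, fun t ht => ?_,
    ⟨?_, ?_, ordinaryHypergeometric_half⟩, hasSum_catalanConst⟩
  · have hre : t.re < 1 / 2 := (Complex.re_le_norm t).trans_lt ht
    rw [← (Ladder.imGen_genF_eq_hyp3F2 hre).2]
    exact Ladder.hasSum_imGen (fun t => Ladder.hasSum_genF) ht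
  · have hre : t.re < 3 / 2 := ((Complex.re_le_norm t).trans_lt ht).trans (by norm_num)
    have ht1 : t ≠ 1 := by rintro rfl; simp at ht
    rw [← (Ladder.imGen_genG_eq_hyp3F2 hre ht1).2]
    exact Ladder.hasSum_imGen (fun t => Ladder.hasSum_genG) ht
  · rw [Ladder.ordinaryHypergeometric_half, Ladder.F_one]; ring
  · rw [Ladder.ordinaryHypergeometric_half, Ladder.G_one]; ring
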